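/- Let $\sigma_1,\sigma_2,\sigma_3$ be the Pauli matrices, $D_a=-i\partial_a$, and on $\mathbb R^2$ let $H_0=D_x\sigma_3-D_y\sigma_2+y\,\sigma_1$. Let $E\in\mathbb R$ with $E^2\neq 2n$ for all $n\in\mathbb N$ (including $n=0$). **Modes.** Let $\varphi_n$ be the $L^2$-normalized Hermite functions $\varphi_n=(2^n n!)^{-1/2}(-\partial_y+y)^n\varphi_0$, $\varphi_0=\pi^{-1/4}e^{-y^2/2}$. Let $M$ be the set of pairs $m=(n,\epsilon_m)$, $n\in\mathbb N$, $\epsilon_m=\pm1$, without $(0,+1)$. For $m=(0,-1)$ put $\xi_m=-E$, $\phi_m=(0,\varphi_0)^T$; for $n\ge1$ put $\xi_m=\epsilon_m(E^2-2n)^{1/2}$ (with $\sqrt{-1}=i$) and $\phi_m=c_m(\sqrt{2n}\,\varphi_{n-1},(E-\xi_m)\varphi_n)^T$, $c_m=(2n+|E-\xi_m|^2)^{-1/2}$. Then $\psi_m=e^{i\xi_m x}\phi_m(y)$ solves $(H_0-E)\psi_m=0$. Let $M(E)=\{m\in M: E^2>2n\}$ (propagating modes) and $\tilde\psi_m=(E/\xi_m)^{1/2}\psi_m$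 for $m\in M(E)$. The coefficients $\alpha_m(x)$ of $\psi(x,\cdot)=\sum_{m\in M}\alpha_m(x)\phi_m$ are $\alpha_m(x)=\langle\vartheta_m,\psi(x,\cdot)\rangle_{L^2(\mathbb R_y)}$ with $(\vartheta_m)$ dual to $(\phi_m)$. **Potential.** Let $V(x,y)=V_1(x)\sigma_3$, where $V_1:\mathbb R\to\mathbb R$ is measurable and $(1+x^2)^{h/2}|V_1(x)|\le C$ for some $h>1$ and $C$. Put $W(x)=\int_{-\infty}^xV_1(x')\,dx'$. **Scattering matrix.** A generalized eigenfunction is a distributional solution $\psi$ of $(H_0+V-E)\psi=0$ that is continuous in $x$ with values in $L^2(\mathbb R_y;\mathbb C^2)$. It has coefficients $\beta(\pm)\in\mathbb C^{M(E)}$ if $\|\psi(x,\cdot)-\sum_{m\in M(E)}\beta_m(\pm)\tilde\psi_m(x,\cdot)\|_{L^2(\mathbb R_y)}\to0$ as $x\to\pm\infty$. Its incoming coefficients are $\beta_m(-)$ for $\epsilon_m=1$ and $\beta_m(+)$ for $\epsilon_m=-1$; its outgoing ones are $\beta_m(+)$ for $\epsilon_m=1$ and $\beta_m(-)$ for $\epsilon_m=-1$.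 The scattering matrix $S$ maps incoming to outgoing coefficients, where all incoming coefficients have to be attained. **TR matrix.** Let $V_1$ in addition be supported in $[x_L,x_R]$, $x_L<x_R$. For $p\in M$ let $\psi^p_{in}=e^{i\xi_p(x-x_L)}\phi_p$ if $\epsilon_p=1$ and $\psi^p_{in}=e^{i\xi_p(x-x_R)}\phi_p$ if $\epsilon_p=-1$, and let $\psi^p_{out}$ be the outgoing solution of $(H_0+V-E)\psi^p_{out}=-V\psi^p_{in}$, i.e. the one that has only modes with $\epsilon=-1$ for $x\le x_L$ and only modes with $\epsilon=+1$ for $x\ge x_R$. Then $T_{m,p}$ ($m,p\in M$) is the coefficient $\alpha_m$ of $\psi^p_{in}+\psi^p_{out}$ at $x_R$ if $\epsilon_m=1$, and at $x_L$ if $\epsilon_m=-1$. **Proposition.** 1. $V_1$ is integrable and $W(+\infty):=\lim_{x\to+\infty}W(x)=\int_{\mathbb R}V_1$. 2. For each generalized eigenfunction with coefficients $\beta(\pm)$, $\beta_m(+)=e^{-iW(+\infty)}\beta_m(-)$ for all $m\in M(E)$. 3. The scattering matrix exists, is unique and is diagonal: $S_{m,m}=e^{-i\epsilon_mW(+\infty)}$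 for $m\in M(E)$, that is $e^{-iW(+\infty)}$ for $\epsilon_m=1$ and $e^{iW(+\infty)}$ for $\epsilon_m=-1$; and $S_{m,p}=0$ for $m\ne p$. 4. If $V_1$ is supported in $[x_L,x_R]$, the TR matrix exists, is unique and is diagonal, with $T_{m,m}=e^{-i\epsilon_mW(+\infty)}\,e^{i\epsilon_m\xi_m(x_R-x_L)}$ for $m\in M$ (the second factor is the entry for $V=0$); all other entries vanish. 5. The data contain exactly the information $W(+\infty)$ modulo $2\pi$: two potentials $V_1\sigma_3$, $V_2\sigma_3$ as above have the same scattering matrix (respectively, if both are supported in $[x_L,x_R]$, the same TR matrix) if and only if $\int_{\mathbb R}V_1-\int_{\mathbb R}V_2\in2\pi\mathbb Z$. In particular, nothing about $V$ but the total integral $\int_{\mathbb R}V_1$ can be recovered. -/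

import Mathlib

open MeasureTheory Filter Topology Complex
open scoped Matrix ContDiff

namespace DiracWaveguide

noncomputable section

/-! ### The unperturbed Dirac operator -/

/-- The first Pauli matrix. -/
def pauli1 : Matrix (Fin 2) (Fin 2) ℂ := !![0, 1; 1, 0]

/-- The second Pauli matrix. -/
def pauli2 : Matrix (Fin 2) (Fin 2) ℂ := !![0, -I; I, 0]

/-- The third Pauli matrix. -/
def pauli3 : Matrix (Fin 2) (Fin 2) ℂ := !![1, 0; 0, -1]

/-- `H₀ χ = D_x σ₃ χ - D_y σ₂ χ + y σ₁ χ` with `D_a = -i ∂_a`, for a differentiable spinor field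
`χ` on the plane with coordinates `p = (x, y)`. -/
def diracFree (χ : ℝ × ℝ → Fin 2 → ℂ) (p : ℝ × ℝ) : Fin 2 → ℂ :=
  pauli3 *ᵥ ((-I) • fderiv ℝ χ p (1, 0)) - pauli2 *ᵥ ((-I) • fderiv ℝ χ p (0, 1))
    + (p.2 : ℂ) • (pauli1 *ᵥ χ p)

/-! ### Modes of the unperturbed operator -/

/-- `𝔞* f = -f' + y f`. -/
def creation (f : ℝ → ℝ) (y : ℝ) : ℝ := -deriv f y + y * f y

/-- The ground state `π^(-1/4) exp (-y²/2)`. -/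
def groundState (y : ℝ) : ℝ := Real.pi ^ (-(1 / 4) : ℝ) * Real.exp (-(y ^ 2) / 2)

/-- The `L²`-normalized Hermite functions `φ_n = (2ⁿ n!)^(-1/2) (𝔞*)ⁿ φ₀`. -/
def hermiteFun (n : ℕ) (y : ℝ) : ℝ :=
  (1 / √((2 : ℝ) ^ n * (n.factorial : ℝ))) * (creation^[n] groundState) y

/-- The index set `M`: the pairs `(n, ε)` with `ε = ±1`, where only `(0, -1)` occurs for
`n = 0`. -/
abbrev Mode : Type := {m : ℕ × ℤˣ // m.1 = 0 → m.2 = -1}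

/-- The number `n` of the mode `m = (n, ε)`. -/
def Mode.level (m : Mode) : ℕ := m.1.1

/-- The sign `ε` of the mode `m = (n, ε)`. -/
def Mode.sign (m : Mode) : ℤˣ := m.1.2

/-- The longitudinal wave number: `-E` for `(0, -1)`, and `ε (E² - 2n)^(1/2)` for `n ≥ 1`, with the
principal square root (so `√(-1) = i`). -/
def waveNumber (E : ℝ) (m : Mode) : ℂ :=
  if m.level = 0 then -(E : ℂ)
  else ((m.sign : ℤ) : ℂ) * ((E ^ 2 - 2 * (m.level : ℝ) : ℝ) : ℂ) ^ (1 / 2 : ℂ)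

/-- The transverse profile of a mode: `(0, φ₀)` for `(0, -1)`, and the normalized vector
`c_m (√(2n) φ_{n-1}, (E - ξ_m) φ_n)` for `n ≥ 1`. -/
def transverse (E : ℝ) (m : Mode) (y : ℝ) : Fin 2 → ℂ :=
  if m.level = 0 then ![0, (hermiteFun 0 y : ℂ)]
  else ((1 / √(2 * (m.level : ℝ) + ‖(E : ℂ) - waveNumber E m‖ ^ 2) : ℝ) : ℂ) •
    ![((√(2 * (m.level : ℝ)) * hermiteFun (m.level - 1) y : ℝ) : ℂ),
      ((E : ℂ) - waveNumber E m) * (hermiteFun m.level y : ℂ)]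

/-- The solution `ψ_m(x, y) = e^{i ξ_m x} φ_m(y)` of `(H₀ - E) ψ = 0`. -/
def modeWave (E : ℝ) (m : Mode) (p : ℝ × ℝ) : Fin 2 → ℂ :=
  exp (I * waveNumber E m * (p.1 : ℂ)) • transverse E m p.2

/-- The set `M(E)` of propagating modes. -/
abbrev PropMode (E : ℝ) : Type := {m : Mode // 2 * (m.level : ℝ) < E ^ 2}

instance PropMode.instFinite (E : ℝ) : Finite (PropMode E) := by
  obtain ⟨N, hN⟩ := exists_nat_gt (E ^ 2)
  have key : ∀ m : PropMode E, m.1.level < N := fun m => by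
    have h1 := m.2
    have h2 : (0 : ℝ) ≤ (m.1.level : ℝ) := Nat.cast_nonneg _
    have h3 : (m.1.level : ℝ) < (N : ℝ) := by linarith
    exact_mod_cast h3
  refine Finite.of_injective
    (fun m : PropMode E => ((⟨m.1.level, key m⟩, m.1.sign) : Fin N × ℤˣ)) ?_
  intro a b hab
  have h1 : a.1.1.1 = b.1.1.1 := congrArg (fun q : Fin N × ℤˣ => (q.1 : ℕ)) hab
  have h2 : a.1.1.2 = b.1.1.2 := congrArg (fun q : Fin N × ℤˣ => q.2) hab
  exact Subtype.ext (Subtype.ext (Prod.ext h1 h2))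

instance PropMode.instFintype (E : ℝ) : Fintype (PropMode E) := Fintype.ofFinite _

/-- The rescaled propagating mode `√(E / ξ_m) ψ_m` (principal square root). -/
def normalizedModeWave (E : ℝ) (m : PropMode E) (p : ℝ × ℝ) : Fin 2 → ℂ :=
  ((E : ℂ) / waveNumber E m.1) ^ (1 / 2 : ℂ) • modeWave E m.1 p

/-! ### Solutions of the perturbed equation -/

/-- Spinor fields that are continuous in `x` with values in `L²(ℝ_y; ℂ²)`, so that all traces on
vertical lines make sense. The norm on `ℂ²` enters only through finiteness of `L²` norms and
convergence to zero, so that any choice of norm on `ℂ²` gives the same class. -/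
structure IsWave (ψ : ℝ × ℝ → Fin 2 → ℂ) : Prop where
  aestronglyMeasurable : AEStronglyMeasurable ψ volume
  memLp : ∀ x : ℝ, MemLp (fun y : ℝ => ψ (x, y)) 2 volume
  continuous : ∀ x₀ : ℝ, Tendsto
    (fun x : ℝ => eLpNorm (fun y : ℝ => ψ (x, y) - ψ (x₀, y)) 2 volume) (𝓝 x₀) (𝓝 0)

/-- `(H₀ + V - E) ψ = f` in the sense of distributions (`V` bounded and measurable): `H₀` is
formally self-adjoint, and is moved to the test function. -/
def IsWeakSolution (E : ℝ) (V : ℝ × ℝ → Matrix (Fin 2) (Fin 2) ℂ)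
    (ψ f : ℝ × ℝ → Fin 2 → ℂ) : Prop :=
  ∀ χ : ℝ × ℝ → Fin 2 → ℂ, ContDiff ℝ ∞ χ → HasCompactSupport χ →
    ∫ p : ℝ × ℝ, (star (diracFree χ p - (E : ℂ) • χ p) ⬝ᵥ ψ p + star (χ p) ⬝ᵥ (V p *ᵥ ψ p))
      = ∫ p : ℝ × ℝ, star (χ p) ⬝ᵥ f p

/-- Generalized eigenfunctions: `(H₀ + V - E) ψ = 0`. -/
def IsGeneralizedEigenfunction (E : ℝ) (V : ℝ × ℝ → Matrix (Fin 2) (Fin 2) ℂ)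
    (ψ : ℝ × ℝ → Fin 2 → ℂ) : Prop :=
  IsWave ψ ∧ IsWeakSolution E V ψ 0

/-! ### The scattering matrix -/

/-- `‖ψ(x, ·) - ∑_{m ∈ M(E)} β_m ψ̃_m(x, ·)‖_{L²(ℝ_y)} → 0` along `l` (`x → +∞` or `x → -∞`). -/
def HasAsymptotics (E : ℝ) (ψ : ℝ × ℝ → Fin 2 → ℂ) (l : Filter ℝ) (β : PropMode E → ℂ) : Prop :=
  Tendsto (fun x : ℝ => eLpNorm
    (fun y : ℝ => ψ (x, y) - ∑ m : PropMode E, β m • normalizedModeWave E m (x, y)) 2 volume)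
    l (𝓝 0)

/-- Incoming coefficients: those of the modes `ε = +1` at `-∞` and of the modes `ε = -1` at `+∞`. -/
def incoming {E : ℝ} (βL βR : PropMode E → ℂ) (m : PropMode E) : ℂ :=
  if m.1.sign = 1 then βL m else βR m

/-- Outgoing coefficients: those of the modes `ε = +1` at `+∞` and of the modes `ε = -1` at `-∞`. -/
def outgoing {E : ℝ} (βL βR : PropMode E → ℂ) (m : PropMode E) : ℂ :=
  if m.1.sign = 1 then βR m else βL m

/-- `S` is the scattering matrix of `H₀ + V` at energy `E`: all incoming coefficients are realized
by a generalized eigenfunction, and `S` maps the incoming to the outgoing coefficients of each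
generalized eigenfunction. There is at most one such `S`. -/
def IsScatteringMatrix (E : ℝ) (V : ℝ × ℝ → Matrix (Fin 2) (Fin 2) ℂ)
    (S : Matrix (PropMode E) (PropMode E) ℂ) : Prop :=
  (∀ b : PropMode E → ℂ, ∃ (ψ : ℝ × ℝ → Fin 2 → ℂ) (βL βR : PropMode E → ℂ),
    IsGeneralizedEigenfunction E V ψ ∧ HasAsymptotics E ψ atBot βL ∧ HasAsymptotics E ψ atTop βR ∧
      incoming βL βR = b) ∧
  ∀ (ψ : ℝ × ℝ → Fin 2 → ℂ) (βL βR : PropMode E → ℂ),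
    IsGeneralizedEigenfunction E V ψ → HasAsymptotics E ψ atBot βL → HasAsymptotics E ψ atTop βR →
      outgoing βL βR = S *ᵥ incoming βL βR

/-! ### The transmission-reflection matrix -/

/-- The inner product of `L²(ℝ_y; ℂ²)`, conjugate-linear in the first argument. -/
def innerY (u v : ℝ → Fin 2 → ℂ) : ℂ := ∫ y : ℝ, star (u y) ⬝ᵥ v y

/-- The transverse profile of `(n, ε)`, with the convention `φ_{(0,+1)} = 0`. -/
def transverseExt (E : ℝ) (n : ℕ) (ε : ℤˣ) : ℝ → Fin 2 → ℂ :=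
  if h : n = 0 → ε = -1 then transverse E ⟨(n, ε), h⟩ else 0

/-- `P_n = ⟨φ_{n+}, φ_{n-}⟩`. -/
def overlap (E : ℝ) (n : ℕ) : ℂ := innerY (transverseExt E n 1) (transverseExt E n (-1))

/-- The dual profiles `ϑ_{n-} = (φ_{n-} - P_n φ_{n+}) / (1 - |P_n|²)` and
`ϑ_{n+} = (φ_{n+} - conj(P_n) φ_{n-}) / (1 - |P_n|²)`. -/
def dualProfile (E : ℝ) (m : Mode) (y : ℝ) : Fin 2 → ℂ :=
  ((1 / (1 - ‖overlap E m.level‖ ^ 2) : ℝ) : ℂ) •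
    (if m.sign = 1 then
      transverseExt E m.level 1 y - star (overlap E m.level) • transverseExt E m.level (-1) y
    else
      transverseExt E m.level (-1) y - overlap E m.level • transverseExt E m.level 1 y)

/-- The coefficient `α_m(x)` of `ψ(x, ·) = ∑_m α_m(x) φ_m`. -/
def modeCoeff (E : ℝ) (m : Mode) (ψ : ℝ × ℝ → Fin 2 → ℂ) (x : ℝ) : ℂ :=
  innerY (dualProfile E m) (fun y : ℝ => ψ (x, y))

/-- The incoming wave of the mode `p` for the slab `[xL, xR]`, entering at `xL` if `ε_p = +1` and at
`xR` if `ε_p = -1`, with amplitude one there. -/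
def incomingWave (E xL xR : ℝ) (p : Mode) (q : ℝ × ℝ) : Fin 2 → ℂ :=
  exp (I * waveNumber E p * ((q.1 - (if p.sign = 1 then xL else xR) : ℝ) : ℂ)) •
    transverse E p q.2

/-- The outgoing solution generated by the mode `p`, for `V` supported in `[xL, xR] × ℝ`:
`(H₀ + V - E) ψout = -V ψin`, with only modes `ε = -1` to the left of the slab and only modes
`ε = +1` to its right. -/
structure IsOutgoingSolution (E : ℝ) (V : ℝ × ℝ → Matrix (Fin 2) (Fin 2) ℂ) (xL xR : ℝ) (p : Mode)
    (ψout : ℝ × ℝ → Fin 2 → ℂ) : Prop where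
  isWave : IsWave ψout
  equation : IsWeakSolution E V ψout (fun q => -(V q *ᵥ incomingWave E xL xR p q))
  left : ∀ m : Mode, m.sign = 1 → ∀ x : ℝ, x ≤ xL → modeCoeff E m ψout x = 0
  right : ∀ m : Mode, m.sign = -1 → ∀ x : ℝ, xR ≤ x → modeCoeff E m ψout x = 0

/-- `T` is the transmission-reflection matrix of the slab `[xL, xR]` at energy `E`: the outgoing
solutions exist, and `T m p` is the coefficient `α_m` of `ψin + ψout` at `xR` if `ε_m = +1`, and at
`xL` if `ε_m = -1`, where `ψin` is the incoming wave of the mode `p`. There is at most one such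
`T`. -/
def IsTRMatrix (E : ℝ) (V : ℝ × ℝ → Matrix (Fin 2) (Fin 2) ℂ) (xL xR : ℝ)
    (T : Matrix Mode Mode ℂ) : Prop :=
  ∀ p : Mode, (∃ ψout, IsOutgoingSolution E V xL xR p ψout) ∧
    ∀ ψout, IsOutgoingSolution E V xL xR p ψout → ∀ m : Mode,
      T m p = modeCoeff E m (fun q => incomingWave E xL xR p q + ψout q)
        (if m.sign = 1 then xR else xL)

/-! ### The potentials `V₁(x) σ₃` -/

/-- The potential `V(x, y) = V₁(x) σ₃`. -/
def sigma3Potential (V₁ : ℝ → ℝ) (p : ℝ × ℝ) : Matrix (Fin 2) (Fin 2) ℂ :=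
  (V₁ p.1 : ℂ) • pauli3

/-- The short-range condition `(1 + x²)^(h/2) |V₁(x)| ≤ C` for some `h > 1` and some `C`. -/
def IsShortRange (V₁ : ℝ → ℝ) : Prop :=
  ∃ h C : ℝ, 1 < h ∧ ∀ x : ℝ, (1 + x ^ 2) ^ (h / 2) * |V₁ x| ≤ C

/-- `W(x) = ∫_{-∞}^x V₁`. -/
def primitive (V₁ : ℝ → ℝ) (x : ℝ) : ℝ := ∫ t in Set.Iic x, V₁ t

end

end DiracWaveguide

open DiracWaveguide

open scoped ENNReal

/-! ### Absolutely continuous functions with a prescribed derivative -/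

namespace DiracWaveguide

/-! The potential is a pure gauge. Since the scalar phase `exp (-iW(x))` commutes with all Pauli
matrices, `D_x σ₃ + V₁ σ₃` is the conjugate of `D_x σ₃` by it, so every solution is this phase times
a free solution: modes never couple, nothing is reflected, and each mode, propagating or evanescent,
only acquires the phase.

Solutions are merely distributional and continuous in `x`, so the gauge change is carried out on
coefficients. The transverse part `-D_y σ₂ + y σ₁` equals its own transpose, and `φ_m` satisfies
`(-D_y σ₂ + y σ₁ - E) φ_m = -ξ_m σ₃ φ_m`. Hence the bilinear pairing `q_m(x) = ∫ φ_mᵀ σ₃ ψ(x, ·)`,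
which has no complex conjugation and so also suits imaginary `ξ_m`, obeys the scalar equation `q_m'
= i (ξ_m - V₁) q_m`. This is `isACPrimitive_modePairing`; it comes from testing with `g(x) θ(y) conj
φ_m(y)`, removing the cutoff `θ` by dominated convergence, and applying the du Bois-Reymond lemma.
As `V₁` is only bounded and measurable, the equation holds almost everywhere for an absolutely
continuous `q_m`. The integrating factor makes `q_m exp (-iξ_m x + iW)` constant
(`modePairing_propagation`).

The pairing reads off modal coefficients because the modes are orthogonal for it, with nonzero
squares (`modePairing_transverse`, `ampSq_ne_zero`); here `E² ≠ 2n`, that is `ξ_m ≠ 0`, is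
essential. Consequently the dual profiles are multiples of `conj (σ₃ φ_m)` (`star_dualProfile`).

Constancy gives the phase relation at `±∞` (`asymptotics_phase`) and across the slab
(`modeCoeff_outgoing`), hence uniqueness of both matrices. Existence uses the explicit waves `exp
(iξ_m x - iW(x)) φ_m(y)`, which solve the equation by `isWeakSolution_mul_transverse`. Finally, the
diagonal entries depend on `V₁` only through `exp (∓ i ∫ V₁)`, and the mode `(0, -1)` always
propagates, so exactly `∫ V₁` modulo `2π` is visible. -/

/-- `F` is locally absolutely continuous with almost everywhere derivative `f`. -/
structure IsACPrimitive (F f : ℝ → ℂ) : Prop where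
  ac : ∀ a b : ℝ, AbsolutelyContinuousOnInterval F a b
  hasDerivAt : ∀ᵐ x, HasDerivAt F (f x) x
  locallyIntegrable : LocallyIntegrable f volume

lemma absolutelyContinuousOnInterval_const {X : Type*} [PseudoMetricSpace X] (k : X) (a b : ℝ) :
    AbsolutelyContinuousOnInterval (fun _ : ℝ => k) a b :=
  ((LipschitzWith.const k).lipschitzOnWith (s := Set.uIcc a b)).absolutelyContinuousOnInterval

lemma absolutelyContinuousOnInterval_smul_const {f : ℝ → ℝ} {a b : ℝ}
    (hf : AbsolutelyContinuousOnInterval f a b) (k : ℂ) :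
    AbsolutelyContinuousOnInterval (fun x => f x • k) a b :=
  hf.smul (absolutelyContinuousOnInterval_const k a b)

lemma intervalIntegrable_of_locallyIntegrable {F : Type*} [NormedAddCommGroup F] {f : ℝ → F}
    (hf : LocallyIntegrable f volume) (a b : ℝ) : IntervalIntegrable f volume a b :=
  intervalIntegrable_iff.mpr <|
    (hf.integrableOn_isCompact isCompact_uIcc).mono_set Set.uIoc_subset_uIcc

lemma absolutelyContinuousOnInterval_integral {f : ℝ → ℝ} (hf : LocallyIntegrable f volume)
    (a b : ℝ) : AbsolutelyContinuousOnInterval (fun x => ∫ t in (0 : ℝ)..x, f t) a b := by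
  -- The base point `0` of the integral need not lie between `a` and `b`, so the interval is
  -- enlarged to contain all three points and the result restricted.
  have h : IntervalIntegrable f volume (min (min a b) 0) (max (max a b) 0) :=
    intervalIntegrable_of_locallyIntegrable hf _ _
  refine (h.absolutelyContinuousOnInterval_intervalIntegral (c := 0) ?_).mono ?_
  · exact Set.mem_uIcc_of_le (min_le_right _ _) (le_max_right _ _)
  · exact Set.uIcc_subset_uIcc
      (Set.mem_uIcc_of_le ((min_le_left _ _).trans (min_le_left _ _))
        ((le_max_left _ _).trans (le_max_left _ _)))
      (Set.mem_uIcc_of_le ((min_le_left _ _).trans (min_le_right _ _))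
        ((le_max_right _ _).trans (le_max_left _ _)))

namespace IsACPrimitive

lemma intervalIntegral {f : ℝ → ℂ} (hf : LocallyIntegrable f volume) :
    IsACPrimitive (fun x => ∫ t in (0 : ℝ)..x, f t) f where
  ac a b := by
    have hre : LocallyIntegrable (fun x => (f x).re) volume := fun x => by
      obtain ⟨s, hs, h⟩ := hf x
      exact ⟨s, hs, h.re⟩
    have him : LocallyIntegrable (fun x => (f x).im) volume := fun x => by
      obtain ⟨s, hs, h⟩ := hf x
      exact ⟨s, hs, h.im⟩
    have h := (absolutelyContinuousOnInterval_smul_const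
      (absolutelyContinuousOnInterval_integral hre a b) 1).add
      (absolutelyContinuousOnInterval_smul_const
        (absolutelyContinuousOnInterval_integral him a b) I)
    convert! h using 1
    funext x
    have hi : IntervalIntegrable f volume 0 x :=
        intervalIntegrable_of_locallyIntegrable hf _ _
    have h1 := Complex.reCLM.intervalIntegral_comp_comm hi
    have h2 := Complex.imCLM.intervalIntegral_comp_comm hi
    simp only [Complex.reCLM_apply, Complex.imCLM_apply] at h1 h2
    simp only [Pi.add_apply, h1, h2]
    apply Complex.ext <;> simp
  hasDerivAt := by
    filter_upwards [_root_.LocallyIntegrable.ae_hasDerivAt_integral hf] with x hx using hx 0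
  locallyIntegrable := hf

lemma of_contDiff {F : ℝ → ℂ} (hF : ContDiff ℝ 1 F) : IsACPrimitive F (deriv F) where
  ac _ _ := hF.contDiffOn.absolutelyContinuousOnInterval
  hasDerivAt := Eventually.of_forall fun x =>
    (hF.differentiable one_ne_zero x).hasDerivAt
  locallyIntegrable := (hF.continuous_deriv le_rfl).locallyIntegrable

lemma continuous {F f : ℝ → ℂ} (h : IsACPrimitive F f) : Continuous F := by
  refine continuous_iff_continuousAt.2 fun x => ?_
  have := (h.ac (x - 1) (x + 1)).continuousOn
  refine this.continuousAt ?_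
  rw [Set.uIcc_of_le (by linarith)]
  exact Icc_mem_nhds (by linarith) (by linarith)

lemma mul {F f G g : ℝ → ℂ} (hF : IsACPrimitive F f) (hG : IsACPrimitive G g) :
    IsACPrimitive (fun x => F x * G x) (fun x => f x * G x + F x * g x) where
  ac a b := (hF.ac a b).smul (hG.ac a b)
  hasDerivAt := by
    filter_upwards [hF.hasDerivAt, hG.hasDerivAt] with x h1 h2 using h1.mul h2
  locallyIntegrable := by
    refine LocallyIntegrable.add ?_ ?_
    · rw [locallyIntegrable_iff]
      intro K hK
      exact (hF.locallyIntegrable.integrableOn_isCompact hK).mul_continuousOn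
        hG.continuous.continuousOn hK
    · rw [locallyIntegrable_iff]
      intro K hK
      exact (hG.locallyIntegrable.integrableOn_isCompact hK).continuousOn_mul
        hF.continuous.continuousOn hK

lemma sub {F f G g : ℝ → ℂ} (hF : IsACPrimitive F f) (hG : IsACPrimitive G g) :
    IsACPrimitive (fun x => F x - G x) (fun x => f x - g x) where
  ac a b := (hF.ac a b).sub (hG.ac a b)
  hasDerivAt := by
    filter_upwards [hF.hasDerivAt, hG.hasDerivAt] with x h1 h2 using h1.sub h2
  locallyIntegrable := hF.locallyIntegrable.sub hG.locallyIntegrable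

/-- Absolute continuity is what excludes Cantor-type functions here. All uniqueness statements about
the modal equations rest on this. -/
lemma eq_of_ae_zero {F f : ℝ → ℂ} (h : IsACPrimitive F f) (h0 : ∀ᵐ x, f x = 0) (x y : ℝ) :
    F x = F y := by
  obtain ⟨C, hC⟩ := (h.ac x y).const_of_ae_hasDerivAt_zero (by
    filter_upwards [h.hasDerivAt, h0] with t ht h0 _
    rwa [h0] at ht)
  rw [hC x Set.left_mem_uIcc, hC y Set.right_mem_uIcc]

lemma integral_eq {F f : ℝ → ℂ} (h : IsACPrimitive F f) (a b : ℝ) :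
    ∫ x in a..b, f x = F b - F a := by
  have := (h.sub (intervalIntegral h.locallyIntegrable)).eq_of_ae_zero (by simp) a b
  have h2 := intervalIntegral.integral_add_adjacent_intervals
    (intervalIntegrable_of_locallyIntegrable h.locallyIntegrable 0 a)
    (intervalIntegrable_of_locallyIntegrable h.locallyIntegrable a b)
  linear_combination h2 + this

/-- Integration by parts: the integrand is the derivative of `g H`, which vanishes at both ends of
an interval containing the support of `g`. -/
lemma integral_test_mul {H h g : ℝ → ℂ} (hH : IsACPrimitive H h) (hg : ContDiff ℝ 1 g)
    (hc : HasCompactSupport g) : ∫ x, (deriv g x * H x + g x * h x) = 0 := by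
  obtain ⟨R, hR⟩ := hc.isCompact.isBounded.subset_ball 0
  have hz : ∀ x, x ∉ Metric.ball (0 : ℝ) R → g x = 0 := fun x hx =>
    image_eq_zero_of_notMem_tsupport fun h => hx (hR h)
  have hz' : ∀ x, x ∉ Metric.ball (0 : ℝ) R → deriv g x = 0 := fun x hx =>
    image_eq_zero_of_notMem_tsupport fun h => hx (hR (tsupport_deriv_subset h))
  have hs : Function.support (fun x => deriv g x * H x + g x * h x) ⊆ Set.Ioc (-R) R := by
    intro x hx
    by_contra hx'
    apply hx
    have : x ∉ Metric.ball (0 : ℝ) R := fun hb => hx' (by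
      rw [Real.ball_eq_Ioo] at hb
      exact ⟨by linarith [hb.1], by linarith [hb.2]⟩)
    simp [hz x this, hz' x this]
  rw [← intervalIntegral.integral_eq_integral_of_support_subset hs,
    ((of_contDiff hg).mul hH).integral_eq, hz R (by simp [Real.ball_eq_Ioo]),
    hz (-R) (by simp [Real.ball_eq_Ioo])]
  simp

end IsACPrimitive

/-! ### Weak derivatives on the line -/

/-- A smooth compactly supported function with vanishing integral has a smooth compactly supported
primitive. -/
lemma exists_primitive_of_integral_eq_zero {h : ℝ → ℝ} (hh : ContDiff ℝ ∞ h)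
    (hc : HasCompactSupport h) (h0 : ∫ x, h x = 0) :
    ∃ g : ℝ → ℝ, ContDiff ℝ ∞ g ∧ HasCompactSupport g ∧ deriv g = h := by
  obtain ⟨R, hR⟩ := hc.isCompact.isBounded.subset_ball 0
  have hz : ∀ x, x ∉ Metric.ball (0 : ℝ) R → h x = 0 := fun x hx =>
    image_eq_zero_of_notMem_tsupport fun h => hx (hR h)
  have hd : ∀ x, HasDerivAt (fun x => ∫ t in (-R)..x, h t) (h x) x := fun x =>
    intervalIntegral.integral_hasDerivAt_right (hh.continuous.intervalIntegrable _ _)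
      (hh.continuous.stronglyMeasurableAtFilter _ _) hh.continuous.continuousAt
  have hderiv : deriv (fun x => ∫ t in (-R)..x, h t) = h := funext fun x => (hd x).deriv
  refine ⟨fun x => ∫ t in (-R)..x, h t, ?_, ?_, hderiv⟩
  · rw [contDiff_infty_iff_deriv, hderiv]
    exact ⟨fun x => (hd x).differentiableAt, hh⟩
  · refine HasCompactSupport.intro (isCompact_Icc (a := -R) (b := R)) fun x hx => ?_
    rcases le_or_gt x R with hxR | hxR
    · have hx' : x < -R := by
        by_contra hcon
        exact hx ⟨not_lt.1 hcon, hxR⟩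
      refine intervalIntegral.integral_zero_ae (Eventually.of_forall fun t ht => hz t ?_)
      rw [Set.uIoc_of_ge hx'.le] at ht
      rw [Real.ball_eq_Ioo]
      intro hb
      linarith [ht.2, hb.1]
    -- To the right of the ball the primitive has collected all of `h`, and this total is zero.
    · rw [intervalIntegral.integral_eq_integral_of_support_subset, h0]
      intro t ht
      by_contra hcon
      refine ht (hz t fun hb => hcon ?_)
      rw [Real.ball_eq_Ioo] at hb
      exact ⟨by linarith [hb.1], by linarith [hb.2]⟩

/-- The lemma of du Bois-Reymond. -/
lemma eq_const_of_integral_deriv_mul_eq_zero {f : ℝ → ℂ} (hf : Continuous f)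
    (h : ∀ g : ℝ → ℝ, ContDiff ℝ ∞ g → HasCompactSupport g → ∫ x, ((deriv g x : ℝ) : ℂ) * f x = 0)
    (x y : ℝ) : f x = f y := by
  let b : ContDiffBump (0 : ℝ) := ⟨1, 2, one_pos, one_lt_two⟩
  let ρ : ℝ → ℝ := b.normed volume
  have hρ : ContDiff ℝ ∞ ρ := b.contDiff_normed
  have hρc : HasCompactSupport ρ := b.hasCompactSupport_normed
  have hρi : ∫ x, ρ x = 1 := b.integral_normed
  -- The candidate constant is the average of `f` against a bump of mass one. For a test function
  -- `φ`, the difference `φ - (∫ φ) ρ` has integral zero, so it is the derivative of a test function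
  -- and integrates to zero against `f`.
  let k : ℂ := ∫ x, (ρ x : ℂ) * f x
  have key : ∀ᵐ x, f x - k = 0 := by
    refine ae_eq_zero_of_integral_contDiff_smul_eq_zero
      (hf.sub continuous_const).locallyIntegrable fun φ hφ hφc => ?_
    let s : ℝ := ∫ x, φ x
    have hint : ∀ u : ℝ → ℝ, ContDiff ℝ ∞ u → HasCompactSupport u → Integrable u := fun u hu huc =>
      hu.continuous.integrable_of_hasCompactSupport huc
    have hintf : ∀ u : ℝ → ℝ, ContDiff ℝ ∞ u → HasCompactSupport u →
        Integrable (fun x => (u x : ℂ) * f x) := fun u hu huc => by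
      refine Continuous.integrable_of_hasCompactSupport
        ((continuous_ofReal.comp hu.continuous).mul hf) ?_
      exact (huc.comp_left (g := fun r : ℝ => (r : ℂ)) (by simp)).mul_right
    obtain ⟨g, hg, hgc, hgd⟩ := exists_primitive_of_integral_eq_zero
      (h := fun x => φ x - s * ρ x) (hφ.sub (contDiff_const.mul hρ))
      (hφc.sub hρc.mul_left) (by
        rw [integral_sub (hint φ hφ hφc) ((hint ρ hρ hρc).const_mul s), integral_const_mul, hρi]
        simp [s])
    have h1 := h g hg hgc
    simp only [hgd] at h1
    have h2 : ∫ x, ((φ x : ℂ) * f x - s * ((ρ x : ℂ) * f x)) = 0 := by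
      rw [← h1]
      congr 1
      funext x
      push_cast
      ring
    rw [integral_sub (hintf φ hφ hφc) ((hintf ρ hρ hρc).const_mul _), integral_const_mul] at h2
    have h3 : ∫ x, φ x • (f x - k) = ∫ x, ((φ x : ℂ) * f x - (φ x : ℂ) * k) := by
      congr 1
      funext x
      simp [mul_sub]
    have hφk : Integrable (fun x => (φ x : ℂ) * k) := (hint φ hφ hφc).ofReal.mul_const k
    have h4 : ∫ x, (φ x : ℂ) = s := integral_ofReal
    rw [h3, integral_sub (hintf φ hφ hφc) hφk, integral_mul_const, h4]
    linear_combination h2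
  have : ∀ x, f x = k := by
    have := Continuous.ae_eq_iff_eq volume hf (continuous_const (y := k)) |>.1 (by
      filter_upwards [key] with x hx using sub_eq_zero.1 hx)
    exact fun x => congrFun this x
  rw [this x, this y]

/-- A continuous weak solution of `c' = r` is a primitive of `r`. -/
lemma isACPrimitive_of_weak {c r : ℝ → ℂ} (hc : Continuous c) (hr : LocallyIntegrable r volume)
    (h : ∀ g : ℝ → ℝ, ContDiff ℝ ∞ g → HasCompactSupport g →
      ∫ x, (((deriv g x : ℝ) : ℂ) * c x + (g x : ℂ) * r x) = 0) : IsACPrimitive c r := by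
  have hR := IsACPrimitive.intervalIntegral hr
  -- The integral of `r` satisfies the same weak equation as `c`, so their difference has weak
  -- derivative zero.
  have key := eq_const_of_integral_deriv_mul_eq_zero (hc.sub hR.continuous) (fun g hg hgc => by
    have hgC : ContDiff ℝ 1 (fun x => (g x : ℂ)) :=
      (ofRealCLM.contDiff.comp hg).of_le (by exact_mod_cast le_top)
    have hgCc : HasCompactSupport (fun x => (g x : ℂ)) :=
      hgc.comp_left (g := fun r : ℝ => (r : ℂ)) (by simp)
    have hd : ∀ x, deriv (fun x => (g x : ℂ)) x = ((deriv g x : ℝ) : ℂ) := fun x =>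
      ((hg.differentiable (by simp) x).hasDerivAt.ofReal_comp).deriv
    have h2 := hR.integral_test_mul hgC hgCc
    simp only [hd] at h2
    have hgi : Integrable (fun x => (g x : ℂ) * r x) :=
      hr.integrable_smul_left_of_hasCompactSupport hgC.continuous hgCc
    have hdc : Continuous (fun x => ((deriv g x : ℝ) : ℂ)) :=
      continuous_ofReal.comp (hg.continuous_deriv (by simp))
    have hdcc : HasCompactSupport (fun x => ((deriv g x : ℝ) : ℂ)) :=
      hgc.deriv.comp_left (g := fun r : ℝ => (r : ℂ)) (by simp)
    have hi : ∀ u : ℝ → ℂ, Continuous u → Integrable (fun x => ((deriv g x : ℝ) : ℂ) * u x) :=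
      fun u hu => (hdc.mul hu).integrable_of_hasCompactSupport hdcc.mul_right
    have h1 := h g hg hgc
    rw [integral_add (hi c hc) hgi] at h1
    rw [integral_add (hi _ hR.continuous) hgi] at h2
    have h3 : ∫ x, ((deriv g x : ℝ) : ℂ) * (c x - ∫ t in (0 : ℝ)..x, r t) = 0 := by
      rw [← sub_eq_zero.2 (h1.trans h2.symm), add_sub_add_right_eq_sub,
        ← integral_sub (hi c hc) (hi _ hR.continuous)]
      simp only [mul_sub]
    exact h3)
  have heq : c = fun x => (∫ t in (0 : ℝ)..x, r t) - (-(c 0)) := by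
    funext x
    have : c x - ∫ t in (0 : ℝ)..x, r t = c 0 - ∫ t in (0 : ℝ)..0, r t := key x 0
    rw [intervalIntegral.integral_same] at this
    linear_combination this
  have hconst : IsACPrimitive (fun _ => -(c 0)) (fun _ => (0 : ℂ)) := by
    simpa using IsACPrimitive.of_contDiff (contDiff_const (c := -(c 0)))
  rw [heq]
  simpa using hR.sub hconst

/-! ### Hermite functions -/

/-- The function `P(y) exp (-y²/2)`. -/
noncomputable def polyGauss (P : Polynomial ℝ) (y : ℝ) : ℝ := P.eval y * Real.exp (-(y ^ 2) / 2)

lemma hasDerivAt_polyGauss (P : Polynomial ℝ) (y : ℝ) :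
    HasDerivAt (polyGauss P) (polyGauss (P.derivative - Polynomial.X * P) y) y := by
  have h1 := P.hasDerivAt y
  have h2 : HasDerivAt (fun y : ℝ => Real.exp (-(y ^ 2) / 2)) (-y * Real.exp (-(y ^ 2) / 2)) y := by
    convert! (((hasDerivAt_pow 2 y).neg).div_const 2).exp using 1
    simp
    ring
  convert! h1.mul h2 using 1
  simp [polyGauss]
  ring

lemma contDiff_polyGauss (P : Polynomial ℝ) : ContDiff ℝ ∞ (polyGauss P) := by
  have h : ContDiff ℝ ∞ fun y : ℝ => P.eval y := by simpa using P.contDiff_aeval (𝕜 := ℝ) ∞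
  exact h.mul (((contDiff_id.pow 2).neg.div_const 2).exp)

lemma creation_polyGauss (P : Polynomial ℝ) :
    creation (polyGauss P) = polyGauss (2 * Polynomial.X * P - P.derivative) := by
  funext y
  rw [creation, (hasDerivAt_polyGauss P y).deriv]
  simp [polyGauss]
  ring

lemma integrable_polyGauss_mul (P Q : Polynomial ℝ) :
    Integrable (fun y => polyGauss P y * polyGauss Q y) := by
  have key : ∀ R : Polynomial ℝ, Integrable (fun y : ℝ => R.eval y * Real.exp (-1 * y ^ 2)) := by
    intro R
    induction R using Polynomial.induction_on' with
    | add p q hp hq =>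
      refine (hp.add hq).congr (Eventually.of_forall fun y => ?_)
      simp [add_mul]
    | monomial n a =>
      have := (integrable_rpow_mul_exp_neg_mul_sq one_pos (s := n)
        (by linarith [(Nat.cast_nonneg n : (0 : ℝ) ≤ n)])).const_mul a
      refine this.congr (Eventually.of_forall fun y => ?_)
      simp [Polynomial.eval_monomial, mul_assoc]
  refine (key (P * Q)).congr (Eventually.of_forall fun y => ?_)
  simp only [polyGauss, Polynomial.eval_mul]
  have : Real.exp (-1 * y ^ 2) = Real.exp (-(y ^ 2) / 2) * Real.exp (-(y ^ 2) / 2) := by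
    rw [← Real.exp_add]; congr 1; ring
  rw [this]
  ring

/-- The polynomial factor of `(𝔞*)ⁿ φ₀`. -/
noncomputable def hermitePoly : ℕ → Polynomial ℝ
  | 0 => Polynomial.C (Real.pi ^ (-(1 / 4) : ℝ))
  | n + 1 => 2 * Polynomial.X * hermitePoly n - (hermitePoly n).derivative

lemma creation_iterate_groundState (n : ℕ) :
    creation^[n] groundState = polyGauss (hermitePoly n) := by
  induction n with
  | zero => funext y; simp [groundState, polyGauss, hermitePoly]
  | succ n ih => rw [Function.iterate_succ_apply', ih, creation_polyGauss, hermitePoly]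

/-- On functions `P exp (-y²/2)` the operator `d/dy + y` acts as `P ↦ P'`, so this is the lowering
relation. The induction commutes the derivative past the raising recursion. -/
lemma derivative_hermitePoly_succ (n : ℕ) :
    (hermitePoly (n + 1)).derivative = Polynomial.C (2 * ((n : ℝ) + 1)) * hermitePoly n := by
  have two : (2 : Polynomial ℝ) = Polynomial.C 2 := rfl
  induction n with
  | zero => simp [hermitePoly, two]
  | succ n ih =>
    rw [hermitePoly, Polynomial.derivative_sub, Polynomial.derivative_mul,
      Polynomial.derivative_mul, ih, Polynomial.derivative_mul]
    nth_rw 1 [hermitePoly]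
    rw [hermitePoly]
    simp [two]
    ring

lemma hermiteFun_eq (n : ℕ) : hermiteFun n =
    polyGauss (Polynomial.C (1 / √((2 : ℝ) ^ n * (n.factorial : ℝ))) * hermitePoly n) := by
  funext y
  rw [hermiteFun, creation_iterate_groundState]
  simp [polyGauss, mul_assoc]

lemma contDiff_hermiteFun (n : ℕ) : ContDiff ℝ ∞ (hermiteFun n) := by
  rw [hermiteFun_eq]; exact contDiff_polyGauss _

lemma integrable_hermiteFun_mul (m n : ℕ) : Integrable (fun y => hermiteFun m y * hermiteFun n y) := by
  rw [hermiteFun_eq, hermiteFun_eq]; exact integrable_polyGauss_mul _ _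

lemma hermiteFun_norm_succ (n : ℕ) :
    1 / √((2 : ℝ) ^ n * (n.factorial : ℝ)) =
      √(2 * ((n : ℝ) + 1)) * (1 / √((2 : ℝ) ^ (n + 1) * ((n + 1).factorial : ℝ))) := by
  have : (2 : ℝ) ^ (n + 1) * ((n + 1).factorial : ℝ) =
      (2 * ((n : ℝ) + 1)) * ((2 : ℝ) ^ n * (n.factorial : ℝ)) := by
    rw [Nat.factorial_succ]; push_cast; ring
  have h1 : √(2 * ((n : ℝ) + 1)) ≠ 0 := by positivity
  rw [this, Real.sqrt_mul (show 0 ≤ 2 * ((n : ℝ) + 1) by positivity)]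
  generalize √((2 : ℝ) ^ n * (n.factorial : ℝ)) = t
  generalize √(2 * ((n : ℝ) + 1)) = s at h1 ⊢
  field_simp

/-- `-φ_n' + y φ_n = √(2(n+1)) φ_{n+1}`. -/
lemma hasDerivAt_hermiteFun_raise (n : ℕ) (y : ℝ) : HasDerivAt (hermiteFun n)
    (y * hermiteFun n y - √(2 * ((n : ℝ) + 1)) * hermiteFun (n + 1) y) y := by
  rw [hermiteFun_eq (n + 1)]
  have h := hasDerivAt_polyGauss
    (Polynomial.C (1 / √((2 : ℝ) ^ n * (n.factorial : ℝ))) * hermitePoly n) y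
  rw [← hermiteFun_eq n] at h
  convert! h using 1
  rw [hermiteFun_eq]
  simp only [polyGauss, hermitePoly, Polynomial.eval_mul, Polynomial.eval_C, Polynomial.eval_sub,
    Polynomial.derivative_mul, Polynomial.derivative_C, Polynomial.eval_add, Polynomial.eval_X,
    Polynomial.eval_zero, hermiteFun_norm_succ n, Polynomial.eval_ofNat]
  ring

/-- `φ_{n+1}' + y φ_{n+1} = √(2(n+1)) φ_n`. -/
lemma hasDerivAt_hermiteFun_lower (n : ℕ) (y : ℝ) : HasDerivAt (hermiteFun (n + 1))
    (√(2 * ((n : ℝ) + 1)) * hermiteFun n y - y * hermiteFun (n + 1) y) y := by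
  have h := hasDerivAt_polyGauss
    (Polynomial.C (1 / √((2 : ℝ) ^ (n + 1) * ((n + 1).factorial : ℝ))) * hermitePoly (n + 1)) y
  rw [← hermiteFun_eq (n + 1)] at h
  convert! h using 1
  rw [hermiteFun_eq, hermiteFun_eq]
  have hs : √(2 * ((n : ℝ) + 1)) * √(2 * ((n : ℝ) + 1)) = 2 * ((n : ℝ) + 1) :=
    Real.mul_self_sqrt (by positivity)
  simp only [polyGauss, Polynomial.eval_mul, Polynomial.eval_C, Polynomial.eval_sub,
    Polynomial.derivative_mul, Polynomial.derivative_C, Polynomial.eval_add, Polynomial.eval_X,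
    Polynomial.eval_zero, hermiteFun_norm_succ n, derivative_hermitePoly_succ]
  linear_combination (1 / √((2 : ℝ) ^ (n + 1) * ((n + 1).factorial : ℝ))) *
    Polynomial.eval y (hermitePoly n) * Real.exp (-(y ^ 2) / 2) * hs

lemma hasDerivAt_hermiteFun_zero (y : ℝ) :
    HasDerivAt (hermiteFun 0) (-(y * hermiteFun 0 y)) y := by
  have h := hasDerivAt_polyGauss
    (Polynomial.C (1 / √((2 : ℝ) ^ 0 * (Nat.factorial 0 : ℝ))) * hermitePoly 0) y
  rw [← hermiteFun_eq 0] at h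
  convert! h using 1
  rw [hermiteFun_eq]
  simp [polyGauss, hermitePoly]
  ring

/-- Raising and lowering are mutually adjoint: in the derivative of `φ_{m+1} φ_n` the two terms with
the factor `y` cancel, and the integral of what remains vanishes. -/
lemma integral_hermiteFun_succ_mul_succ (m n : ℕ) :
    √(2 * ((n : ℝ) + 1)) * ∫ y, hermiteFun (m + 1) y * hermiteFun (n + 1) y =
      √(2 * ((m : ℝ) + 1)) * ∫ y, hermiteFun m y * hermiteFun n y := by
  have h := integral_eq_zero_of_hasDerivAt_of_integrable
    (f := fun y => hermiteFun (m + 1) y * hermiteFun n y)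
    (f' := fun y => √(2 * ((m : ℝ) + 1)) * (hermiteFun m y * hermiteFun n y)
      - √(2 * ((n : ℝ) + 1)) * (hermiteFun (m + 1) y * hermiteFun (n + 1) y))
    (fun y => by
      convert! (hasDerivAt_hermiteFun_lower m y).mul (hasDerivAt_hermiteFun_raise n y) using 1
      ring)
    (((integrable_hermiteFun_mul m n).const_mul _).sub
      ((integrable_hermiteFun_mul (m + 1) (n + 1)).const_mul _))
    (integrable_hermiteFun_mul (m + 1) n)
  rw [integral_sub ((integrable_hermiteFun_mul m n).const_mul _)
      ((integrable_hermiteFun_mul (m + 1) (n + 1)).const_mul _),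
    integral_const_mul, integral_const_mul] at h
  linarith

lemma integral_hermiteFun_zero_mul_succ (n : ℕ) :
    ∫ y, hermiteFun 0 y * hermiteFun (n + 1) y = 0 := by
  have h := integral_eq_zero_of_hasDerivAt_of_integrable
    (f := fun y => hermiteFun 0 y * hermiteFun n y)
    (f' := fun y => -√(2 * ((n : ℝ) + 1)) * (hermiteFun 0 y * hermiteFun (n + 1) y))
    (fun y => by
      convert! (hasDerivAt_hermiteFun_zero y).mul (hasDerivAt_hermiteFun_raise n y) using 1
      ring)
    ((integrable_hermiteFun_mul 0 (n + 1)).const_mul _) (integrable_hermiteFun_mul 0 n)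
  rw [integral_const_mul] at h
  have h1 : √(2 * ((n : ℝ) + 1)) ≠ 0 := by positivity
  exact (mul_eq_zero.1 h).resolve_left (neg_ne_zero.2 h1)

lemma integral_hermiteFun_zero_mul_zero : ∫ y, hermiteFun 0 y * hermiteFun 0 y = 1 := by
  have h : ∀ y, hermiteFun 0 y * hermiteFun 0 y = Real.pi ^ (-(1 / 2) : ℝ) *
      Real.exp (-1 * y ^ 2) := fun y => by
    have e1 : Real.pi ^ (-(1 / 2) : ℝ) = Real.pi ^ (-(1 / 4) : ℝ) * Real.pi ^ (-(1 / 4) : ℝ) := by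
      rw [← Real.rpow_add Real.pi_pos]; norm_num
    have e2 : Real.exp (-1 * y ^ 2) = Real.exp (-(y ^ 2) / 2) * Real.exp (-(y ^ 2) / 2) := by
      rw [← Real.exp_add]; congr 1; ring
    rw [e1, e2]
    simp [hermiteFun, groundState]
    ring
  simp only [h]
  rw [integral_const_mul, integral_gaussian, div_one, Real.sqrt_eq_rpow,
    ← Real.rpow_add Real.pi_pos]
  norm_num

lemma integral_hermiteFun_mul (m n : ℕ) :
    ∫ y, hermiteFun m y * hermiteFun n y = if m = n then 1 else 0 := by
  induction m generalizing n with
  | zero =>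
    cases n with
    | zero => simpa using integral_hermiteFun_zero_mul_zero
    | succ n => simpa using integral_hermiteFun_zero_mul_succ n
  | succ m ih =>
    cases n with
    | zero =>
      simp only [mul_comm (hermiteFun (m + 1) _)]
      simpa using integral_hermiteFun_zero_mul_succ m
    | succ n =>
      have h := integral_hermiteFun_succ_mul_succ m n
      have h1 : √(2 * ((n : ℝ) + 1)) ≠ 0 := by positivity
      rw [ih] at h
      by_cases hmn : m = n
      · subst hmn
        rw [if_pos rfl, mul_right_inj' h1] at h
        rw [h, if_pos rfl]
      · rw [if_neg hmn, mul_zero] at h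
        rw [if_neg (by omega), (mul_eq_zero.1 h).resolve_left h1]

lemma memLp_hermiteFun (n : ℕ) : MemLp (fun y => (hermiteFun n y : ℂ)) 2 volume := by
  have : MemLp (hermiteFun n) 2 volume := by
    rw [memLp_two_iff_integrable_sq (contDiff_hermiteFun n).continuous.aestronglyMeasurable]
    simpa [sq] using integrable_hermiteFun_mul n n
  exact this.ofReal

/-! ### Algebra of the modes -/

/-- The coefficient of `φ_{n-1}` in the first component of a transverse profile. -/
noncomputable def upperAmp (E : ℝ) (m : Mode) : ℂ :=
  if m.level = 0 then 0
  else ((1 / √(2 * (m.level : ℝ) + ‖(E : ℂ) - waveNumber E m‖ ^ 2) : ℝ) : ℂ) *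
    ((√(2 * (m.level : ℝ)) : ℝ) : ℂ)

/-- The coefficient of `φ_n` in the second component of a transverse profile. -/
noncomputable def lowerAmp (E : ℝ) (m : Mode) : ℂ :=
  if m.level = 0 then 1
  else ((1 / √(2 * (m.level : ℝ) + ‖(E : ℂ) - waveNumber E m‖ ^ 2) : ℝ) : ℂ) *
    ((E : ℂ) - waveNumber E m)

lemma transverse_eq (E : ℝ) (m : Mode) (y : ℝ) : transverse E m y =
    ![upperAmp E m * (hermiteFun (m.level - 1) y : ℂ), lowerAmp E m * (hermiteFun m.level y : ℂ)] := by
  unfold transverse upperAmp lowerAmp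
  split_ifs with h
  · simp [h]
  · simp [mul_assoc]

lemma transverse_zero (E : ℝ) (m : Mode) (y : ℝ) :
    transverse E m y 0 = upperAmp E m * (hermiteFun (m.level - 1) y : ℂ) := by
  simp [transverse_eq]

lemma transverse_one (E : ℝ) (m : Mode) (y : ℝ) :
    transverse E m y 1 = lowerAmp E m * (hermiteFun m.level y : ℂ) := by
  simp [transverse_eq]

lemma waveNumber_sq (E : ℝ) (m : Mode) :
    waveNumber E m ^ 2 = (E : ℂ) ^ 2 - 2 * (m.level : ℂ) := by
  unfold waveNumber
  split_ifs with h
  · simp [h]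
  · rw [mul_pow, ← Complex.cpow_nat_mul]
    have hs : ((m.sign : ℤ) : ℂ) ^ 2 = 1 := by
      rcases Int.units_eq_one_or m.sign with h | h <;> simp [h]
    rw [hs]
    norm_num

lemma waveNumber_ne_zero {E : ℝ} (hE : ∀ n : ℕ, E ^ 2 ≠ 2 * (n : ℝ)) (m : Mode) :
    waveNumber E m ≠ 0 := by
  intro h
  have h2 := waveNumber_sq E m
  rw [h] at h2
  apply hE m.level
  have : ((E ^ 2 : ℝ) : ℂ) = ((2 * (m.level : ℝ) : ℝ) : ℂ) := by
    push_cast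
    linear_combination -h2
  exact_mod_cast this

lemma sqrt_level_mul_self (m : Mode) :
    ((√(2 * (m.level : ℝ)) : ℝ) : ℂ) * ((√(2 * (m.level : ℝ)) : ℝ) : ℂ) = 2 * (m.level : ℂ) := by
  rw [← Complex.ofReal_mul, Real.mul_self_sqrt (by positivity)]
  push_cast
  rfl

lemma lowerAmp_mul_sqrt (E : ℝ) (m : Mode) :
    lowerAmp E m * ((√(2 * (m.level : ℝ)) : ℝ) : ℂ) =
      ((E : ℂ) - waveNumber E m) * upperAmp E m := by
  unfold lowerAmp upperAmp
  split_ifs with h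
  · simp [h]
  · ring

lemma upperAmp_mul_sqrt (E : ℝ) (m : Mode) :
    upperAmp E m * ((√(2 * (m.level : ℝ)) : ℝ) : ℂ) =
      ((E : ℂ) + waveNumber E m) * lowerAmp E m := by
  unfold lowerAmp upperAmp
  split_ifs with h
  · simp [waveNumber, h]
  · rw [mul_assoc, sqrt_level_mul_self]
    linear_combination ((1 / √(2 * (m.level : ℝ) + ‖(E : ℂ) - waveNumber E m‖ ^ 2) : ℝ) : ℂ) *
      (waveNumber_sq E m)

lemma norm_amp_sq_add (E : ℝ) (m : Mode) :
    star (upperAmp E m) * upperAmp E m + star (lowerAmp E m) * lowerAmp E m = 1 := by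
  have hn : ∀ z : ℂ, star z * z = ((‖z‖ ^ 2 : ℝ) : ℂ) := fun z => by
    rw [Complex.star_def, Complex.conj_mul']; push_cast; rfl
  rw [hn, hn, ← Complex.ofReal_add, ← Complex.ofReal_one]
  congr 1
  unfold lowerAmp upperAmp
  split_ifs with h
  · simp
  · have hpos : 0 < 2 * (m.level : ℝ) + ‖(E : ℂ) - waveNumber E m‖ ^ 2 := by
      have : (0 : ℝ) < m.level := by exact_mod_cast Nat.pos_of_ne_zero h
      positivity
    rw [norm_mul, norm_mul, Complex.norm_real, Complex.norm_real, Real.norm_of_nonneg (by positivity),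
      Real.norm_of_nonneg (by positivity), mul_pow, mul_pow, Real.sq_sqrt (by positivity), div_pow,
      Real.sq_sqrt hpos.le]
    field_simp

lemma upperAmp_eq_zero_of_level {E : ℝ} {m : Mode} (h : m.level = 0) : upperAmp E m = 0 := by
  simp [upperAmp, h]

lemma lowerAmp_of_level {E : ℝ} {m : Mode} (h : m.level = 0) : lowerAmp E m = 1 := by
  simp [lowerAmp, h]

lemma mode_ext {m p : Mode} (h1 : m.level = p.level) (h2 : m.sign = p.sign) : m = p :=
  Subtype.ext (Prod.ext h1 h2)

/-- Level `0` carries only one sign, so the common level is positive; there the wave numbers are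
opposite and nonzero. -/
lemma waveNumber_ne_of_sign {E : ℝ} (hE : ∀ n : ℕ, E ^ 2 ≠ 2 * (n : ℝ)) {m p : Mode}
    (h1 : m.level = p.level) (h2 : m.sign ≠ p.sign) : waveNumber E m ≠ waveNumber E p := by
  have h0 : m.level ≠ 0 := fun h0 => h2 ((m.2 h0).trans (p.2 (h1.symm.trans h0)).symm)
  have hneg : waveNumber E p = -waveNumber E m := by
    have hs : p.sign = -m.sign := by
      rcases Int.units_eq_one_or m.sign with h | h <;>
        rcases Int.units_eq_one_or p.sign with h' | h' <;> simp_all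
    simp [waveNumber, ← h1, h0, hs]
  rw [hneg]
  intro h
  apply waveNumber_ne_zero hE m
  linear_combination h / 2

/-- The amplitudes of different modes of the same level are `σ₃`-orthogonal. -/
lemma amp_orthogonal {E : ℝ} (hE : ∀ n : ℕ, E ^ 2 ≠ 2 * (n : ℝ)) {m p : Mode}
    (h1 : m.level = p.level) (h2 : m.sign ≠ p.sign) :
    upperAmp E m * upperAmp E p - lowerAmp E m * lowerAmp E p = 0 := by
  have hne := sub_ne_zero.2 (waveNumber_ne_of_sign hE h1 h2)
  have a1 := lowerAmp_mul_sqrt E m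
  have a2 := upperAmp_mul_sqrt E m
  have b1 := lowerAmp_mul_sqrt E p
  have b2 := upperAmp_mul_sqrt E p
  rw [← h1] at b1 b2
  -- With `s = √(2n)`, the amplitude vector `v` of a mode solves `(s σ₁ - E) v = -ξ σ₃ v`. Both
  -- matrices are symmetric, so vectors for different `ξ` are bilinearly `σ₃`-orthogonal: subtract
  -- the two equations tested against each other.
  refine (mul_eq_zero.1 (?_ : (waveNumber E m - waveNumber E p) * _ = 0)).resolve_left hne
  linear_combination upperAmp E p * a1 + lowerAmp E p * a2 - upperAmp E m * b1 - lowerAmp E m * b2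

/-- The `σ₃`-square of the amplitudes of a mode. -/
noncomputable def ampSq (E : ℝ) (m : Mode) : ℂ := upperAmp E m ^ 2 - lowerAmp E m ^ 2

/-- A `σ₃`-isotropic amplitude would have components equal up to sign. The two amplitude relations
then give `2 ξ_m` times the lower one `= 0`, so `ξ_m ≠ 0` forces the whole vector to vanish, against
its normalization. -/
lemma ampSq_ne_zero {E : ℝ} (hE : ∀ n : ℕ, E ^ 2 ≠ 2 * (n : ℝ)) (m : Mode) : ampSq E m ≠ 0 := by
  intro h
  have a1 := lowerAmp_mul_sqrt E m
  have a2 := upperAmp_mul_sqrt E m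
  have a3 := norm_amp_sq_add E m
  have hξ := waveNumber_ne_zero hE m
  have hf : (upperAmp E m - lowerAmp E m) * (upperAmp E m + lowerAmp E m) = 0 := by
    rw [← h, ampSq]; ring
  have hz : lowerAmp E m = 0 → False := fun h0 => by
    have hu : upperAmp E m = 0 := by simpa [ampSq, h0] using h
    simp [h0, hu] at a3
  rcases mul_eq_zero.1 hf with h' | h'
  · have hu : upperAmp E m = lowerAmp E m := sub_eq_zero.1 h'
    rw [hu] at a1 a2
    have : 2 * waveNumber E m * lowerAmp E m = 0 := by linear_combination a1 - a2
    simp [hξ] at this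
    exact hz this
  · have hu : upperAmp E m = -lowerAmp E m := eq_neg_of_add_eq_zero_left h'
    rw [hu] at a1 a2
    have : 2 * waveNumber E m * lowerAmp E m = 0 := by linear_combination -a1 - a2
    simp [hξ] at this
    exact hz this

/-! ### Transverse differential equations -/

lemma hasDerivAt_hermiteFun (n : ℕ) (y : ℝ) : HasDerivAt (hermiteFun n)
    (√(2 * (n : ℝ)) * hermiteFun (n - 1) y - y * hermiteFun n y) y := by
  cases n with
  | zero => simpa using hasDerivAt_hermiteFun_zero y
  | succ n => simpa using hasDerivAt_hermiteFun_lower n y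

/-- Together with `hasDerivAt_transverse_zero` this is the transverse eigenvalue equation `(-D_y σ₂
+ y σ₁ - E) φ_m = -ξ_m σ₃ φ_m`, written by components. -/
lemma hasDerivAt_transverse_one (E : ℝ) (m : Mode) (y : ℝ) :
    HasDerivAt (fun y => transverse E m y 1)
      (((E : ℂ) - waveNumber E m) * transverse E m y 0 - y * transverse E m y 1) y := by
  simp only [transverse_zero, transverse_one]
  convert! ((hasDerivAt_hermiteFun m.level y).ofReal_comp).const_mul (lowerAmp E m) using 1
  push_cast
  linear_combination -(hermiteFun (m.level - 1) y : ℂ) * lowerAmp_mul_sqrt E m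

lemma hasDerivAt_transverse_zero (E : ℝ) (m : Mode) (y : ℝ) :
    HasDerivAt (fun y => transverse E m y 0)
      (y * transverse E m y 0 - ((E : ℂ) + waveNumber E m) * transverse E m y 1) y := by
  simp only [transverse_zero, transverse_one]
  by_cases h : m.level = 0
  · simp only [upperAmp_eq_zero_of_level h, zero_mul]
    convert! hasDerivAt_const y (0 : ℂ) using 1
    simp [waveNumber, h]
  · obtain ⟨n, hn⟩ := Nat.exists_eq_succ_of_ne_zero h
    have h2 := upperAmp_mul_sqrt E m
    rw [hn] at h2 ⊢
    convert! ((hasDerivAt_hermiteFun_raise n y).ofReal_comp).const_mul (upperAmp E m) using 1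
    push_cast at h2 ⊢
    simp only [Nat.succ_eq_add_one] at h2 ⊢
    linear_combination (hermiteFun (n + 1) y : ℂ) * h2

lemma contDiff_transverse (E : ℝ) (m : Mode) (i : Fin 2) :
    ContDiff ℝ ∞ (fun y => transverse E m y i) := by
  have h : ∀ n, ContDiff ℝ ∞ (fun y => (hermiteFun n y : ℂ)) := fun n =>
    ofRealCLM.contDiff.comp (contDiff_hermiteFun n)
  fin_cases i
  · simpa only [Fin.zero_eta, transverse_zero] using contDiff_const.mul (h _)
  · simpa only [Fin.mk_one, transverse_one] using contDiff_const.mul (h _)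

lemma memLp_transverse_apply (E : ℝ) (m : Mode) (i : Fin 2) :
    MemLp (fun y => transverse E m y i) 2 volume := by
  fin_cases i
  · simpa only [Fin.zero_eta, transverse_zero] using (memLp_hermiteFun _).const_mul _
  · simpa only [Fin.mk_one, transverse_one] using (memLp_hermiteFun _).const_mul _

lemma continuous_transverse (E : ℝ) (m : Mode) : Continuous (transverse E m) :=
  continuous_pi fun i => (contDiff_transverse E m i).continuous

lemma memLp_transverse (E : ℝ) (m : Mode) : MemLp (transverse E m) 2 volume :=
  MemLp.of_eval fun i => memLp_transverse_apply E m i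

/-! ### The bilinear pairing with a mode -/

/-- The pairing `∫ φ_mᵀ σ₃ v`. -/
noncomputable def modePairing (E : ℝ) (m : Mode) (v : ℝ → Fin 2 → ℂ) : ℂ :=
  ∫ y : ℝ, (transverse E m y 0 * v y 0 - transverse E m y 1 * v y 1)

lemma integrable_ofReal_hermiteFun_mul (m n : ℕ) :
    Integrable (fun y => (hermiteFun m y : ℂ) * (hermiteFun n y : ℂ)) := by
  simpa using (integrable_hermiteFun_mul m n).ofReal (𝕜 := ℂ)

lemma integral_ofReal_hermiteFun_mul (m n : ℕ) :
    ∫ y, (hermiteFun m y : ℂ) * (hermiteFun n y : ℂ) = if m = n then 1 else 0 := by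
  have h : ∫ y, ((hermiteFun m y * hermiteFun n y : ℝ) : ℂ) =
      ((∫ y, hermiteFun m y * hermiteFun n y : ℝ) : ℂ) := integral_ofReal
  rw [integral_hermiteFun_mul] at h
  simp only [ofReal_mul] at h
  rw [h]
  split_ifs <;> simp

lemma integral_hermite_combination (a b : ℂ) (k l m n : ℕ) :
    ∫ y, (a * ((hermiteFun k y : ℂ) * (hermiteFun l y : ℂ)) +
      b * ((hermiteFun m y : ℂ) * (hermiteFun n y : ℂ))) =
        a * (if k = l then 1 else 0) + b * (if m = n then 1 else 0) := by
  rw [integral_add ((integrable_ofReal_hermiteFun_mul k l).const_mul a)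
    ((integrable_ofReal_hermiteFun_mul m n).const_mul b), integral_const_mul, integral_const_mul,
    integral_ofReal_hermiteFun_mul, integral_ofReal_hermiteFun_mul]

/-- Hermite orthogonality separates the levels; within one level the two signs are separated by
`amp_orthogonal`. -/
lemma modePairing_transverse {E : ℝ} (hE : ∀ n : ℕ, E ^ 2 ≠ 2 * (n : ℝ)) (m p : Mode) :
    modePairing E m (transverse E p) = if m = p then ampSq E m else 0 := by
  have h : modePairing E m (transverse E p) =
      upperAmp E m * upperAmp E p * (if m.level - 1 = p.level - 1 then 1 else 0) +
        (-(lowerAmp E m * lowerAmp E p)) * (if m.level = p.level then 1 else 0) := by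
    rw [← integral_hermite_combination, modePairing]
    congr 1
    funext y
    simp only [transverse_zero, transverse_one]
    ring
  rw [h]
  by_cases h1 : m.level = p.level
  · by_cases h2 : m.sign = p.sign
    · obtain rfl := mode_ext h1 h2
      simp [ampSq]
      ring
    · have hne : m ≠ p := fun h => h2 (h ▸ rfl)
      have := amp_orthogonal hE h1 h2
      simp only [h1, hne, if_true, if_false]
      linear_combination this
  · have hne : m ≠ p := fun h => h1 (h ▸ rfl)
    simp only [h1, hne, if_false, mul_zero, add_zero]
    -- Truncated subtraction lets the levels `0` and `1` share `level - 1 = 0`. No coupling results,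
    -- since the upper amplitude vanishes at level `0`.
    by_cases h3 : m.level - 1 = p.level - 1
    · have h4 : m.level = 0 ∨ p.level = 0 := by omega
      rcases h4 with h4 | h4 <;> simp [upperAmp_eq_zero_of_level h4]
    · simp [h3]

/-! ### Dual profiles -/

/-- In the plane spanned by the unit vectors `a`, `b`, the vector dual to `a` is fixed by its
products with `a` and `b`. The `σ₃`-orthogonality shows that `conj (σ₃ a)` divided by the conjugate
`σ₃`-square has the right products, so it must agree with the Gram formula. The computation goes
through the determinant `a₁ b₂ - a₂ b₁`. -/
lemma dual_pair_identity {a₁ a₂ b₁ b₂ : ℂ} (ha : star a₁ * a₁ + star a₂ * a₂ = 1)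
    (hb : star b₁ * b₁ + star b₂ * b₂ = 1) (hab : a₁ * b₁ - a₂ * b₂ = 0)
    (hκ : a₁ ^ 2 - a₂ ^ 2 ≠ 0) {P : ℂ} (hP : P = star a₁ * b₁ + star a₂ * b₂) :
    ((1 / (1 - ‖P‖ ^ 2) : ℝ) : ℂ) * (star a₁ - P * star b₁) = (a₁ ^ 2 - a₂ ^ 2)⁻¹ * a₁ ∧
    ((1 / (1 - ‖P‖ ^ 2) : ℝ) : ℂ) * (star a₂ - P * star b₂) = (a₁ ^ 2 - a₂ ^ 2)⁻¹ * (-a₂) := by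
  have hd1 : a₁ * (a₁ * b₂ - a₂ * b₁) = b₂ * (a₁ ^ 2 - a₂ ^ 2) := by
    linear_combination -a₂ * hab
  have hd2 : a₂ * (a₁ * b₂ - a₂ * b₁) = b₁ * (a₁ ^ 2 - a₂ ^ 2) := by
    linear_combination -a₁ * hab
  have hdet : a₁ * b₂ - a₂ * b₁ ≠ 0 := by
    intro h
    rw [h, mul_zero] at hd1 hd2
    have h1 : b₂ = 0 := (mul_eq_zero.1 hd1.symm).resolve_right hκ
    have h2 : b₁ = 0 := (mul_eq_zero.1 hd2.symm).resolve_right hκ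
    simp [h1, h2] at hb
  have hdet' : star (a₁ * b₂ - a₂ * b₁) ≠ 0 := star_ne_zero.2 hdet
  have hsP : star P = star b₁ * a₁ + star b₂ * a₂ := by
    rw [hP]; simp; ring
  -- Lagrange's identity: for unit vectors, `1 - |⟨a, b⟩|²` is the squared modulus of the
  -- determinant.
  have hden : ((1 / (1 - ‖P‖ ^ 2) : ℝ) : ℂ) =
      1 / (star (a₁ * b₂ - a₂ * b₁) * (a₁ * b₂ - a₂ * b₁)) := by
    push_cast
    congr 1
    rw [← Complex.conj_mul' P, ← Complex.star_def, hsP, hP]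
    simp only [star_sub, star_mul']
    linear_combination (star b₁ * b₁ + star b₂ * b₂) * -ha - hb
  rw [hden]
  simp only [star_sub, star_mul'] at hdet' ⊢
  constructor
  · have : star a₁ - P * star b₁ = (star a₁ * star b₂ - star a₂ * star b₁) * b₂ := by
      rw [hP]; linear_combination -star a₁ * hb
    rw [this]
    field_simp
    linear_combination -hd1
  · have : star a₂ - P * star b₂ = -(star a₁ * star b₂ - star a₂ * star b₁) * b₁ := by
      rw [hP]; linear_combination -star a₂ * hb
    rw [this]
    field_simp
    linear_combination hd2

lemma overlap_eq {E : ℝ} {m p : Mode} (hmp : m.level = p.level) (h1 : m.sign = 1)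
    (h2 : p.sign = -1) : overlap E m.level =
      star (upperAmp E m) * upperAmp E p + star (lowerAmp E m) * lowerAmp E p := by
  have e1 : transverseExt E m.level 1 = transverse E m := by
    have : m.level = 0 → (1 : ℤˣ) = -1 := fun h => h1.symm.trans (m.2 h)
    rw [transverseExt, dif_pos this]
    congr 1
    exact mode_ext rfl h1.symm
  have e2 : transverseExt E m.level (-1) = transverse E p := by
    rw [transverseExt, dif_pos fun _ => rfl]
    congr 1
    exact mode_ext hmp h2.symm
  rw [overlap, e1, e2, innerY]
  have : ∀ y, star (transverse E m y) ⬝ᵥ transverse E p y =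
      star (upperAmp E m) * upperAmp E p *
        ((hermiteFun (m.level - 1) y : ℂ) * (hermiteFun (p.level - 1) y : ℂ)) +
      star (lowerAmp E m) * lowerAmp E p *
        ((hermiteFun m.level y : ℂ) * (hermiteFun p.level y : ℂ)) := fun y => by
    simp [dotProduct, Fin.sum_univ_two, transverse_zero, transverse_one]
    ring
  simp only [this, integral_hermite_combination, hmp, if_true, mul_one]

lemma star_dualProfile {E : ℝ} (hE : ∀ n : ℕ, E ^ 2 ≠ 2 * (n : ℝ)) (m : Mode) (y : ℝ) :
    star (dualProfile E m y 0) = (ampSq E m)⁻¹ * transverse E m y 0 ∧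
    star (dualProfile E m y 1) = (ampSq E m)⁻¹ * (-transverse E m y 1) := by
  -- At level `0` there is no partner, so the overlap vanishes and the profile is its own dual; the
  -- `σ₃`-square `-1` matches the sign in the second component. At higher levels the partner `p` has
  -- the opposite sign.
  by_cases h0 : m.level = 0
  · have hs : m.sign = -1 := m.2 h0
    have e1 : transverseExt E 0 1 = 0 := by
      rw [transverseExt, dif_neg]
      simp
    have e2 : transverseExt E m.level (-1) = transverse E m := by
      rw [transverseExt, dif_pos fun _ => rfl]
      congr 1
      exact mode_ext rfl hs.symm
    have hov : overlap E m.level = 0 := by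
      rw [overlap, h0, e1]; simp [innerY]
    have hne : (-1 : ℤˣ) ≠ 1 := by decide
    simp [dualProfile, hov, hs, hne, e2, transverse_zero, transverse_one, ampSq,
      upperAmp_eq_zero_of_level h0, lowerAmp_of_level h0]
  · have hext : ∀ (p : Mode), p.level = m.level →
        transverseExt E m.level p.sign = transverse E p := fun p hp => by
      have : m.level = 0 → p.sign = -1 := fun h => absurd h h0
      rw [transverseExt, dif_pos this]
      congr 1
      exact mode_ext hp.symm rfl
    let p : Mode := ⟨(m.level, -m.sign), fun h => absurd h h0⟩
    have hp : p.level = m.level := rfl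
    have hps : p.sign = -m.sign := rfl
    have hne : m.sign ≠ p.sign := by
      rw [hps]; rcases Int.units_eq_one_or m.sign with h | h <;> rw [h] <;> decide
    have horth := amp_orthogonal hE hp.symm hne
    have hκ := ampSq_ne_zero hE m
    rcases Int.units_eq_one_or m.sign with hs | hs
    · rw [hs] at hps
      have hov := overlap_eq (E := E) hp.symm hs hps
      obtain ⟨i1, i2⟩ := dual_pair_identity (norm_amp_sq_add E m) (norm_amp_sq_add E p) horth hκ hov
      have e1 := hext m rfl
      have e2 := hext p hp
      rw [hs] at e1
      rw [hps] at e2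
      unfold dualProfile
      rw [if_pos hs, e1, e2, ampSq]
      simp only [Pi.smul_apply, Pi.sub_apply, smul_eq_mul, star_mul', star_sub, Complex.conj_conj,
        transverse_zero, transverse_one, hp, Complex.star_def, Complex.conj_ofReal] at i1 i2 ⊢
      constructor
      · linear_combination (hermiteFun (m.level - 1) y : ℂ) * i1
      · linear_combination (hermiteFun m.level y : ℂ) * i2
    -- For sign `-1` the two modes exchange roles, so the overlap enters `dual_pair_identity`
    -- conjugated.
    · rw [hs, neg_neg] at hps
      have hov := overlap_eq (E := E) hp hps hs
      rw [hp] at hov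
      have hov' : star (overlap E m.level) =
          star (upperAmp E m) * upperAmp E p + star (lowerAmp E m) * lowerAmp E p := by
        rw [hov]; simp; ring
      obtain ⟨i1, i2⟩ := dual_pair_identity (norm_amp_sq_add E m) (norm_amp_sq_add E p) horth hκ hov'
      rw [norm_star] at i1 i2
      have e1 := hext m rfl
      have e2 := hext p hp
      rw [hs] at e1
      rw [hps] at e2
      have hne1 : m.sign ≠ 1 := by rw [hs]; decide
      unfold dualProfile
      rw [if_neg hne1, e1, e2, ampSq]
      simp only [Pi.smul_apply, Pi.sub_apply, smul_eq_mul, star_mul', star_sub,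
        transverse_zero, transverse_one, hp, Complex.star_def, Complex.conj_ofReal] at i1 i2 ⊢
      constructor
      · linear_combination (hermiteFun (m.level - 1) y : ℂ) * i1
      · linear_combination (hermiteFun m.level y : ℂ) * i2

/-- This replaces the sesquilinear dual coefficient by the bilinear pairing, the quantity that
satisfies a closed equation. -/
lemma modeCoeff_eq {E : ℝ} (hE : ∀ n : ℕ, E ^ 2 ≠ 2 * (n : ℝ)) (m : Mode)
    (ψ : ℝ × ℝ → Fin 2 → ℂ) (x : ℝ) :
    modeCoeff E m ψ x = (ampSq E m)⁻¹ * modePairing E m (fun y => ψ (x, y)) := by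
  rw [modeCoeff, innerY, modePairing, ← integral_const_mul]
  congr 1
  funext y
  obtain ⟨h1, h2⟩ := star_dualProfile hE m y
  simp only [dotProduct, Fin.sum_univ_two, Pi.star_apply, h1, h2]
  ring

lemma exists_waveNumber_eq_ofReal {E : ℝ} (m : PropMode E) :
    ∃ k : ℝ, waveNumber E m.1 = (k : ℂ) := by
  unfold waveNumber
  split_ifs with h
  · exact ⟨-E, by simp⟩
  · refine ⟨((m.1.sign : ℤ) : ℝ) * (E ^ 2 - 2 * (m.1.level : ℝ)) ^ (1 / 2 : ℝ), ?_⟩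
    rw [Complex.ofReal_mul, Complex.ofReal_cpow (by linarith [m.2])]
    push_cast
    rfl

/-! ### Integrability of waves against test functions -/

lemma enorm_apply_le_enorm (v : Fin 2 → ℂ) (i : Fin 2) : ‖v i‖ₑ ≤ ‖v‖ₑ :=
  enorm_le_iff_norm_le.2 (norm_le_pi_norm v i)

lemma lintegral_enorm_mul_enorm_le {F G : Type*} [NormedAddCommGroup F] [NormedAddCommGroup G]
    {u : ℝ → F} {v : ℝ → G} (hu : AEStronglyMeasurable u volume)
    (hv : AEStronglyMeasurable v volume) :
    ∫⁻ y, ‖u y‖ₑ * ‖v y‖ₑ ≤ eLpNorm u 2 volume * eLpNorm v 2 volume := by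
  have h := eLpNorm_le_eLpNorm_mul_eLpNorm_of_nnnorm (p := 2) (q := 2) (r := 1) hu.norm hv.norm
    (fun a b : ℝ => a * b) 1 (Eventually.of_forall fun y => by simp [nnnorm_mul])
  rw [eLpNorm_one_eq_lintegral_enorm, eLpNorm_norm, eLpNorm_norm] at h
  simpa [enorm_mul] using h

/-- Cauchy–Schwarz in `y`. The factor `2` counts the two components, each bounded by the sup norm on
`ℂ²`. -/
lemma enorm_modePairing_le (E : ℝ) (m : Mode) {v : ℝ → Fin 2 → ℂ}
    (hv : AEStronglyMeasurable v volume) :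
    ‖modePairing E m v‖ₑ ≤ 2 * (eLpNorm (transverse E m) 2 volume * eLpNorm v 2 volume) := by
  refine (enorm_integral_le_lintegral_enorm _).trans ?_
  have hu := (continuous_transverse E m).aestronglyMeasurable (μ := volume)
  refine le_trans ?_ (mul_le_mul_right (lintegral_enorm_mul_enorm_le hu hv) 2)
  rw [← lintegral_const_mul' _ _ (by simp)]
  refine lintegral_mono fun y => ?_
  rw [two_mul]
  refine enorm_sub_le.trans (add_le_add ?_ ?_) <;>
  · rw [enorm_mul]
    gcongr
    · exact enorm_apply_le_enorm _ _
    · exact enorm_apply_le_enorm _ _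

lemma integrable_modePairing (E : ℝ) (m : Mode) {v : ℝ → Fin 2 → ℂ} (hv : MemLp v 2 volume) :
    Integrable (fun y => transverse E m y 0 * v y 0 - transverse E m y 1 * v y 1) :=
  ((memLp_transverse_apply E m 0).integrable_mul (hv.eval 0)).sub
    ((memLp_transverse_apply E m 1).integrable_mul (hv.eval 1))

lemma modePairing_sub (E : ℝ) (m : Mode) {v w : ℝ → Fin 2 → ℂ} (hv : MemLp v 2 volume)
    (hw : MemLp w 2 volume) :
    modePairing E m (fun y => v y - w y) = modePairing E m v - modePairing E m w := by
  rw [modePairing, modePairing, modePairing,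
    ← integral_sub (integrable_modePairing E m hv) (integrable_modePairing E m hw)]
  congr 1
  funext y
  simp only [Pi.sub_apply]
  ring

lemma modePairing_add (E : ℝ) (m : Mode) {v w : ℝ → Fin 2 → ℂ} (hv : MemLp v 2 volume)
    (hw : MemLp w 2 volume) :
    modePairing E m (fun y => v y + w y) = modePairing E m v + modePairing E m w := by
  rw [modePairing, modePairing, modePairing,
    ← integral_add (integrable_modePairing E m hv) (integrable_modePairing E m hw)]
  congr 1
  funext y
  simp only [Pi.add_apply]
  ring

lemma modePairing_smul (E : ℝ) (m : Mode) (k : ℂ) (v : ℝ → Fin 2 → ℂ) :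
    modePairing E m (fun y => k • v y) = k * modePairing E m v := by
  rw [modePairing, modePairing, ← integral_const_mul]
  congr 1
  funext y
  simp only [Pi.smul_apply, smul_eq_mul]
  ring

lemma modePairing_sum (E : ℝ) (m : Mode) {ι : Type*} (s : Finset ι) (v : ι → ℝ → Fin 2 → ℂ)
    (hv : ∀ i ∈ s, MemLp (v i) 2 volume) :
    modePairing E m (fun y => ∑ i ∈ s, v i y) = ∑ i ∈ s, modePairing E m (v i) := by
  simp only [modePairing]
  rw [← integral_finsetSum s fun i hi => integrable_modePairing E m (hv i hi)]
  congr 1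
  funext y
  simp only [Finset.sum_apply, Finset.mul_sum, Finset.sum_sub_distrib]

namespace IsWave

variable {ψ : ℝ × ℝ → Fin 2 → ℂ}

/-- A wave is a continuous map into `L²`, hence bounded on compact intervals. -/
lemma exists_eLpNorm_le (h : IsWave ψ) (R : ℝ) :
    ∃ M : ℝ, ∀ x ∈ Set.Icc (-R) R, eLpNorm (fun y => ψ (x, y)) 2 volume ≤ ENNReal.ofReal M := by
  let Ψ : ℝ → Lp (Fin 2 → ℂ) 2 (volume : Measure ℝ) := fun x => (h.memLp x).toLp
  have hc : Continuous Ψ := continuous_iff_continuousAt.2 fun x₀ => by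
    rw [ContinuousAt, tendsto_iff_edist_tendsto_0]
    simp only [Ψ, Lp.edist_toLp_toLp]
    exact h.continuous x₀
  obtain ⟨M, hM⟩ := isCompact_Icc.exists_bound_of_continuousOn (s := Set.Icc (-R) R)
    hc.continuousOn
  refine ⟨M, fun x hx => ?_⟩
  have := hM x hx
  rw [Lp.norm_toLp] at this
  rw [← ENNReal.ofReal_toReal (h.memLp x).eLpNorm_ne_top]
  exact ENNReal.ofReal_le_ofReal this

/-- Tonelli, with Cauchy–Schwarz in `y` and the uniform `L²` bound in `x`. It supplies the
dominating function for removing transverse cutoffs. -/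
lemma integrableOn_strip (h : IsWave ψ) {u : ℝ → ℝ} (hu : MemLp u 2 volume) (R : ℝ) :
    IntegrableOn (fun p : ℝ × ℝ => u p.2 * ‖ψ p‖) (Set.Icc (-R) R ×ˢ Set.univ) volume := by
  obtain ⟨M, hM⟩ := h.exists_eLpNorm_le R
  have hm : AEStronglyMeasurable (fun p : ℝ × ℝ => u p.2 * ‖ψ p‖) volume :=
    (hu.1.comp_snd (μ := volume)).mul h.aestronglyMeasurable.norm
  refine ⟨hm.restrict, ?_⟩
  rw [hasFiniteIntegral_iff_enorm]
  have hm' := hm.restrict (s := Set.Icc (-R) R ×ˢ Set.univ)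
  rw [Measure.volume_eq_prod, ← Measure.prod_restrict] at hm' ⊢
  rw [lintegral_prod _ hm'.enorm, Measure.restrict_univ]
  have hmeas : ∀ x, AEStronglyMeasurable (fun y => ψ (x, y)) volume := fun x => (h.memLp x).1
  calc ∫⁻ x in Set.Icc (-R) R, ∫⁻ y, ‖u y * ‖ψ (x, y)‖‖ₑ
      ≤ ∫⁻ x in Set.Icc (-R) R, eLpNorm u 2 volume * ENNReal.ofReal M := by
        refine setLIntegral_mono' measurableSet_Icc fun x hx => ?_
        simp only [enorm_mul, enorm_norm]
        exact (lintegral_enorm_mul_enorm_le hu.1 (hmeas x)).trans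
          (mul_le_mul_right (hM x hx) _)
    _ < ⊤ := by
        rw [setLIntegral_const]
        refine ENNReal.mul_lt_top (ENNReal.mul_lt_top hu.eLpNorm_lt_top ENNReal.ofReal_lt_top) ?_
        exact measure_Icc_lt_top

lemma integrable_indicator_strip (h : IsWave ψ) {u : ℝ → ℝ} (hu : MemLp u 2 volume) (R : ℝ) :
    Integrable ((Set.Icc (-R) R ×ˢ Set.univ).indicator fun p : ℝ × ℝ => u p.2 * ‖ψ p‖) :=
  (h.integrableOn_strip hu R).integrable_indicator (measurableSet_Icc.prod MeasurableSet.univ)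

lemma norm_le_indicator_strip {u : ℝ → ℝ} {F : ℝ × ℝ → ℂ}
    {R : ℝ} (hb : ∀ p, ‖F p‖ ≤ u p.2 * ‖ψ p‖) (h0 : ∀ p : ℝ × ℝ, p.1 ∉ Set.Icc (-R) R → F p = 0)
    (p : ℝ × ℝ) :
    ‖F p‖ ≤ (Set.Icc (-R) R ×ˢ Set.univ).indicator (fun p : ℝ × ℝ => u p.2 * ‖ψ p‖) p := by
  by_cases hp : p.1 ∈ Set.Icc (-R) R
  · rw [Set.indicator_of_mem (by exact ⟨hp, trivial⟩)]
    exact hb p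
  · rw [Set.indicator_of_notMem (fun hh => hp hh.1), h0 p hp, norm_zero]

lemma integrable_of_bound (h : IsWave ψ) {u : ℝ → ℝ} (hu : MemLp u 2 volume) {F : ℝ × ℝ → ℂ}
    (hF : AEStronglyMeasurable F volume) {R : ℝ} (hb : ∀ p, ‖F p‖ ≤ u p.2 * ‖ψ p‖)
    (h0 : ∀ p : ℝ × ℝ, p.1 ∉ Set.Icc (-R) R → F p = 0) : Integrable F :=
  (h.integrable_indicator_strip hu R).mono' hF
    (Eventually.of_forall (norm_le_indicator_strip hb h0))

lemma continuous_modePairing (h : IsWave ψ) (E : ℝ) (m : Mode) :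
    Continuous fun x => modePairing E m (fun y => ψ (x, y)) := by
  refine continuous_iff_continuousAt.2 fun x₀ => ?_
  rw [ContinuousAt, tendsto_iff_edist_tendsto_0]
  have hlim : Tendsto (fun x => 2 * (eLpNorm (transverse E m) 2 volume *
      eLpNorm (fun y => ψ (x, y) - ψ (x₀, y)) 2 volume)) (𝓝 x₀) (𝓝 0) := by
    have h1 := ENNReal.Tendsto.const_mul (a := eLpNorm (transverse E m) 2 volume) (h.continuous x₀)
      (Or.inr (memLp_transverse E m).eLpNorm_ne_top)
    have h2 := ENNReal.Tendsto.const_mul (a := 2) h1 (Or.inr (by simp))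
    simpa using h2
  refine tendsto_of_tendsto_of_tendsto_of_le_of_le tendsto_const_nhds hlim
    (fun _ => zero_le) fun x => ?_
  rw [edist_eq_enorm_sub, ← modePairing_sub E m (h.memLp x) (h.memLp x₀)]
  exact enorm_modePairing_le E m ((h.memLp x).sub (h.memLp x₀)).1

lemma add {ψ' : ℝ × ℝ → Fin 2 → ℂ} (h : IsWave ψ) (h' : IsWave ψ') :
    IsWave (fun p => ψ p + ψ' p) where
  aestronglyMeasurable := h.aestronglyMeasurable.add h'.aestronglyMeasurable
  memLp x := (h.memLp x).add (h'.memLp x)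
  continuous x₀ := by
    have hlim := (h.continuous x₀).add (h'.continuous x₀)
    rw [add_zero] at hlim
    refine tendsto_of_tendsto_of_tendsto_of_le_of_le tendsto_const_nhds hlim
      (fun _ => zero_le) fun x => ?_
    have := eLpNorm_add_le ((h.memLp x).sub (h.memLp x₀)).1 ((h'.memLp x).sub (h'.memLp x₀)).1
      (p := 2) (by norm_num)
    refine le_trans (le_of_eq ?_) this
    congr 1
    funext y
    simp only [Pi.add_apply, Pi.sub_apply]
    abel

lemma sum {ι : Type*} (s : Finset ι) {Ψ : ι → ℝ × ℝ → Fin 2 → ℂ} (h : ∀ i ∈ s, IsWave (Ψ i)) :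
    IsWave (fun p => ∑ i ∈ s, Ψ i p) := by
  classical
  induction s using Finset.induction_on with
  | empty =>
    simp only [Finset.sum_empty]
    exact ⟨aestronglyMeasurable_const, fun _ => MemLp.zero, fun _ => by simp⟩
  | insert a s ha ih =>
    simp only [Finset.sum_insert ha]
    exact (h a (Finset.mem_insert_self a s)).add
      (ih fun i hi => h i (Finset.mem_insert_of_mem hi))

/-- A continuous amplitude times a transverse profile. -/
lemma mul_transverse {f : ℝ → ℂ} (hf : Continuous f) (E : ℝ) (m : Mode) :
    IsWave (fun p => f p.1 • transverse E m p.2) where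
  aestronglyMeasurable :=
    ((hf.comp continuous_fst).smul
      ((continuous_transverse E m).comp continuous_snd)).aestronglyMeasurable
  memLp x := (memLp_transverse E m).const_smul (f x)
  continuous x₀ := by
    have he : ∀ x, eLpNorm (fun y => f x • transverse E m y - f x₀ • transverse E m y) 2 volume
        = ‖f x - f x₀‖ₑ * eLpNorm (transverse E m) 2 volume := fun x => by
      rw [← eLpNorm_const_smul]
      congr 1
      funext y
      simp [sub_smul]
    simp only [he]
    have h1 : Tendsto (fun x => ‖f x - f x₀‖ₑ) (𝓝 x₀) (𝓝 0) := by
      have := (hf.tendsto x₀)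
      rw [tendsto_iff_edist_tendsto_0] at this
      simpa only [edist_eq_enorm_sub] using this
    have := ENNReal.Tendsto.mul_const (b := eLpNorm (transverse E m) 2 volume) h1
      (Or.inr (memLp_transverse E m).eLpNorm_ne_top)
    simpa using this

end IsWave

/-! ### The weak form of the equation -/

lemma hasDerivAt_fderiv_fst {F : Type*} [NormedAddCommGroup F] [NormedSpace ℝ F] {χ : ℝ × ℝ → F}
    {p : ℝ × ℝ} (h : DifferentiableAt ℝ χ p) :
    HasDerivAt (fun x => χ (x, p.2)) (fderiv ℝ χ p (1, 0)) p.1 :=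
  h.hasFDerivAt.comp_hasDerivAt p.1 ((hasDerivAt_id p.1).prodMk (hasDerivAt_const p.1 p.2))

lemma hasDerivAt_fderiv_snd {F : Type*} [NormedAddCommGroup F] [NormedSpace ℝ F] {χ : ℝ × ℝ → F}
    {p : ℝ × ℝ} (h : DifferentiableAt ℝ χ p) :
    HasDerivAt (fun y => χ (p.1, y)) (fderiv ℝ χ p (0, 1)) p.2 :=
  h.hasFDerivAt.comp_hasDerivAt p.2 ((hasDerivAt_const p.2 p.1).prodMk (hasDerivAt_id p.2))

lemma star_diracFree_sub_dotProduct (E : ℝ) (χ : ℝ × ℝ → Fin 2 → ℂ) (p : ℝ × ℝ) (w : Fin 2 → ℂ) :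
    star (diracFree χ p - (E : ℂ) • χ p) ⬝ᵥ w =
      (I * star (fderiv ℝ χ p (1, 0) 0) + star (fderiv ℝ χ p (0, 1) 1) + p.2 * star (χ p 1)
        - E * star (χ p 0)) * w 0 +
      (-I * star (fderiv ℝ χ p (1, 0) 1) - star (fderiv ℝ χ p (0, 1) 0) + p.2 * star (χ p 0)
        - E * star (χ p 1)) * w 1 := by
  simp only [diracFree, pauli1, pauli2, pauli3, dotProduct, Fin.sum_univ_two, Pi.star_apply,
    Pi.sub_apply, Pi.add_apply, Pi.smul_apply, Matrix.mulVec, smul_eq_mul, Matrix.of_apply,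
    Matrix.cons_val_zero, Matrix.cons_val_one, Complex.star_def, map_sub, map_add, map_mul,
    map_neg, Complex.conj_I, Complex.conj_ofReal, map_zero, map_one]
  linear_combination
    ((starRingEnd ℂ) (fderiv ℝ χ p (0, 1) 0) * w 1
      - (starRingEnd ℂ) (fderiv ℝ χ p (0, 1) 1) * w 0) * Complex.I_mul_I

lemma star_dotProduct_sigma3Potential (V₁ : ℝ → ℝ) (u : Fin 2 → ℂ) (p : ℝ × ℝ) (w : Fin 2 → ℂ) :
    star u ⬝ᵥ (sigma3Potential V₁ p *ᵥ w) =
      V₁ p.1 * (star (u 0) * w 0 - star (u 1) * w 1) := by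
  simp [sigma3Potential, pauli3, dotProduct, Fin.sum_univ_two, Matrix.mulVec]
  ring

/-- The test function `g(x) θ(y) conj φ_m(y)`. -/
noncomputable def modeTest (E : ℝ) (m : Mode) (g θ : ℝ → ℝ) (p : ℝ × ℝ) (j : Fin 2) : ℂ :=
  (g p.1 : ℂ) * ((θ p.2 : ℂ) * star (transverse E m p.2 j))

lemma contDiff_modeTest (E : ℝ) (m : Mode) {g θ : ℝ → ℝ} (hg : ContDiff ℝ ∞ g)
    (hθ : ContDiff ℝ ∞ θ) : ContDiff ℝ ∞ (modeTest E m g θ) := by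
  refine contDiff_pi.2 fun j => ?_
  have h1 : ContDiff ℝ ∞ (fun p : ℝ × ℝ => (g p.1 : ℂ)) :=
    ofRealCLM.contDiff.comp (hg.comp contDiff_fst)
  have h2 : ContDiff ℝ ∞ (fun p : ℝ × ℝ => (θ p.2 : ℂ)) :=
    ofRealCLM.contDiff.comp (hθ.comp contDiff_snd)
  have h3 : ContDiff ℝ ∞ (fun p : ℝ × ℝ => star (transverse E m p.2 j)) :=
    conjCLE.contDiff.comp ((contDiff_transverse E m j).comp contDiff_snd)
  exact h1.mul (h2.mul h3)

lemma hasCompactSupport_modeTest (E : ℝ) (m : Mode) {g θ : ℝ → ℝ} (hg : HasCompactSupport g)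
    (hθ : HasCompactSupport θ) : HasCompactSupport (modeTest E m g θ) := by
  refine HasCompactSupport.intro (hg.isCompact.prod hθ.isCompact) fun p hp => ?_
  funext j
  by_cases h1 : p.1 ∈ tsupport g
  · have h2 : p.2 ∉ tsupport θ := fun h2 => hp ⟨h1, h2⟩
    simp [modeTest, image_eq_zero_of_notMem_tsupport h2]
  · simp [modeTest, image_eq_zero_of_notMem_tsupport h1]

/-- The weak form conjugates the test function, so the conjugate in `modeTest` restores `φ_m`
itself. Its transverse equation turns all terms in `θ`, apart from `g'` and `V₁`, into `-ξ_m g`;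
only a term with `θ'` is left over. -/
lemma weak_integrand_modeTest (E : ℝ) (V₁ : ℝ → ℝ) (m : Mode) {g θ : ℝ → ℝ}
    (hg : ContDiff ℝ ∞ g) (hθ : ContDiff ℝ ∞ θ) (p : ℝ × ℝ) (w : Fin 2 → ℂ) :
    star (diracFree (modeTest E m g θ) p - (E : ℂ) • modeTest E m g θ p) ⬝ᵥ w +
      star (modeTest E m g θ p) ⬝ᵥ (sigma3Potential V₁ p *ᵥ w) =
    (I * ((deriv g p.1 : ℝ) : ℂ) - waveNumber E m * g p.1 + V₁ p.1 * g p.1) * θ p.2 *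
      (transverse E m p.2 0 * w 0 - transverse E m p.2 1 * w 1) +
    g p.1 * ((deriv θ p.2 : ℝ) : ℂ) *
      (transverse E m p.2 1 * w 0 - transverse E m p.2 0 * w 1) := by
  have hd : DifferentiableAt ℝ (modeTest E m g θ) p :=
    (contDiff_modeTest E m hg hθ).differentiable (by simp) p
  have hg' := ((hg.differentiable (by simp) p.1).hasDerivAt).ofReal_comp
  have hθ' := ((hθ.differentiable (by simp) p.2).hasDerivAt).ofReal_comp
  have hx : ∀ j, fderiv ℝ (modeTest E m g θ) p (1, 0) j =
      ((deriv g p.1 : ℝ) : ℂ) * ((θ p.2 : ℂ) * star (transverse E m p.2 j)) := fun j =>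
    (hasDerivAt_pi.1 (hasDerivAt_fderiv_fst hd) j).unique 
      (hg'.mul_const ((θ p.2 : ℂ) * star (transverse E m p.2 j)))
  have hy : ∀ (j : Fin 2) (t : ℂ), HasDerivAt (fun y => transverse E m y j) t p.2 →
      fderiv ℝ (modeTest E m g θ) p (0, 1) j = (g p.1 : ℂ) *
        (((deriv θ p.2 : ℝ) : ℂ) * star (transverse E m p.2 j) + (θ p.2 : ℂ) * star t) :=
    fun j t ht => (hasDerivAt_pi.1 (hasDerivAt_fderiv_snd hd) j).unique
      ((hθ'.fun_mul ht.star).const_mul (g p.1 : ℂ))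
  rw [star_diracFree_sub_dotProduct, star_dotProduct_sigma3Potential, hx, hx,
    hy 0 _ (hasDerivAt_transverse_zero E m p.2), hy 1 _ (hasDerivAt_transverse_one E m p.2)]
  simp only [modeTest, star_add, star_mul', Complex.star_def, Complex.conj_ofReal,
    Complex.conj_conj]
  ring

lemma norm_pairing_integrand_le (E : ℝ) (m : Mode) (y : ℝ) (w : Fin 2 → ℂ) :
    ‖transverse E m y 0 * w 0 - transverse E m y 1 * w 1‖ ≤ 2 * ‖transverse E m y‖ * ‖w‖ ∧
    ‖transverse E m y 1 * w 0 - transverse E m y 0 * w 1‖ ≤ 2 * ‖transverse E m y‖ * ‖w‖ := by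
  have h : ∀ i j, ‖transverse E m y i * w j‖ ≤ ‖transverse E m y‖ * ‖w‖ := fun i j => by
    rw [norm_mul]
    exact mul_le_mul (norm_le_pi_norm _ _) (norm_le_pi_norm _ _) (norm_nonneg _) (norm_nonneg _)
  constructor
  · refine (norm_sub_le _ _).trans ?_
    linarith [h 0 0, h 1 1]
  · refine (norm_sub_le _ _).trans ?_
    linarith [h 1 0, h 0 1]

/-- Smooth cutoffs that exhaust the line, with derivatives tending to zero. -/
lemma exists_cutoff : ∃ (θ : ℕ → ℝ → ℝ) (K : ℝ), (∀ k, ContDiff ℝ ∞ (θ k)) ∧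
    (∀ k, HasCompactSupport (θ k)) ∧ (∀ k y, |θ k y| ≤ 1) ∧ (∀ k y, |deriv (θ k) y| ≤ K) ∧
    (∀ y, Tendsto (fun k => θ k y) atTop (𝓝 1)) ∧
    (∀ y, Tendsto (fun k => deriv (θ k) y) atTop (𝓝 0)) := by
  let b : ContDiffBump (0 : ℝ) := ⟨1, 2, one_pos, one_lt_two⟩
  have hb : ContDiff ℝ ∞ b := b.contDiff
  obtain ⟨K, hK⟩ := (hb.continuous_deriv (by simp)).bounded_above_of_compact_support
    b.hasCompactSupport.deriv
  have hd : ∀ (k : ℕ) y, deriv (fun y => b (((k : ℝ) + 1)⁻¹ * y)) y =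
      ((k : ℝ) + 1)⁻¹ * deriv b (((k : ℝ) + 1)⁻¹ * y) := fun k y => by
    rw [deriv_comp_mul_left]; simp
  have hinv : Tendsto (fun k : ℕ => ((k : ℝ) + 1)⁻¹) atTop (𝓝 0) := by
    simpa using tendsto_one_div_add_atTop_nhds_zero_nat (𝕜 := ℝ)
  refine ⟨fun k y => b (((k : ℝ) + 1)⁻¹ * y), K, fun k => hb.comp (contDiff_const.mul contDiff_id),
    fun k => ?_, fun k y => ?_, fun k y => ?_, fun y => ?_, fun y => ?_⟩
  · have hk : ((k : ℝ) + 1)⁻¹ ≠ 0 := by positivity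
    exact b.hasCompactSupport.comp_homeomorph (Homeomorph.mulLeft₀ _ hk)
  · rw [abs_of_nonneg b.nonneg]; exact b.le_one
  · rw [hd, abs_mul]
    have h1 : |((k : ℝ) + 1)⁻¹| ≤ 1 := by
      rw [abs_of_pos (by positivity)]
      exact inv_le_one_of_one_le₀ (by linarith [(Nat.cast_nonneg k : (0 : ℝ) ≤ k)])
    exact (mul_le_of_le_one_left (abs_nonneg _) h1).trans (hK _)
  · have h1 : Tendsto (fun k : ℕ => ((k : ℝ) + 1)⁻¹ * y) atTop (𝓝 0) := by
      simpa using hinv.mul_const y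
    have h2 := (hb.continuous.tendsto 0).comp h1
    rwa [b.one_of_mem_closedBall (by simp [b.rIn_pos.le])] at h2
  · simp only [hd]
    refine squeeze_zero_norm (fun k => ?_) (by simpa using hinv.mul_const K)
    rw [norm_mul, Real.norm_of_nonneg (by positivity)]
    exact mul_le_mul_of_nonneg_left (hK _) (by positivity)

/-- Here the cutoff is sent to `1`. Neither `φ_m` nor the strip is compact in `y`, but `φ_m` is in
`L²`, so dominated convergence applies and the term with `θ'` disappears. Integrability is part of
the conclusion so that Fubini can be used next. -/
lemma integral_strip_pairing_eq_zero {E : ℝ} {V₁ : ℝ → ℝ} (hV : Measurable V₁) {C : ℝ}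
    (hC : ∀ x, |V₁ x| ≤ C) {ψ : ℝ × ℝ → Fin 2 → ℂ} (hψ : IsWave ψ)
    (hw : IsWeakSolution E (sigma3Potential V₁) ψ 0) (m : Mode) {g : ℝ → ℝ}
    (hg : ContDiff ℝ ∞ g) (hgc : HasCompactSupport g) :
    Integrable (fun p : ℝ × ℝ =>
      (I * ((deriv g p.1 : ℝ) : ℂ) - waveNumber E m * g p.1 + V₁ p.1 * g p.1) *
        (transverse E m p.2 0 * ψ p 0 - transverse E m p.2 1 * ψ p 1)) ∧
    ∫ p : ℝ × ℝ, (I * ((deriv g p.1 : ℝ) : ℂ) - waveNumber E m * g p.1 + V₁ p.1 * g p.1) *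
        (transverse E m p.2 0 * ψ p 0 - transverse E m p.2 1 * ψ p 1) = 0 := by
  obtain ⟨θ, K, hθ, hθc, hθ1, hθK, hθlim, hθlim'⟩ := exists_cutoff
  obtain ⟨R, hR⟩ := hgc.isCompact.isBounded.subset_closedBall 0
  rw [Real.closedBall_eq_Icc, zero_sub, zero_add] at hR
  have hz : ∀ x, x ∉ Set.Icc (-R) R → g x = 0 := fun x hx =>
    image_eq_zero_of_notMem_tsupport fun h => hx (hR h)
  have hz' : ∀ x, x ∉ Set.Icc (-R) R → deriv g x = 0 := fun x hx =>
    image_eq_zero_of_notMem_tsupport fun h => hx (hR (tsupport_deriv_subset h))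
  obtain ⟨G, hG⟩ := hg.continuous.bounded_above_of_compact_support hgc
  obtain ⟨G', hG'⟩ := (hg.continuous_deriv (by simp)).bounded_above_of_compact_support hgc.deriv
  have hG0 : 0 ≤ G := (norm_nonneg _).trans (hG 0)
  have hK0 : 0 ≤ K := (abs_nonneg _).trans (hθK 0 0)
  set q : ℝ → ℂ := fun x => I * ((deriv g x : ℝ) : ℂ) - waveNumber E m * g x + V₁ x * g x with hq
  set L : ℝ := G' + ‖waveNumber E m‖ * G + C * G with hL
  have hqL : ∀ x, ‖q x‖ ≤ L := fun x => by
    refine (norm_add_le _ _).trans (add_le_add ((norm_sub_le _ _).trans (add_le_add ?_ ?_)) ?_)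
    · simpa using hG' x
    · rw [norm_mul, Complex.norm_real]
      exact mul_le_mul_of_nonneg_left (hG x) (norm_nonneg _)
    · rw [norm_mul, Complex.norm_real, Complex.norm_real]
      exact mul_le_mul (hC x) (hG x) (norm_nonneg _) ((abs_nonneg _).trans (hC x))
  have hL0 : 0 ≤ L := (norm_nonneg _).trans (hqL 0)
  have hqm : Measurable q := by
    have h1 : Measurable (deriv g) := measurable_deriv g
    have h2 : Measurable g := hg.continuous.measurable
    exact ((measurable_const.mul (measurable_ofReal.comp h1)).sub
      (measurable_const.mul (measurable_ofReal.comp h2))).add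
      ((measurable_ofReal.comp hV).mul (measurable_ofReal.comp h2))
  have hq0 : ∀ x, x ∉ Set.Icc (-R) R → q x = 0 := fun x hx => by simp [hq, hz x hx, hz' x hx]
  -- The common envelope for all cutoffs: `L` bounds the coefficient of `θ`, `G K` bounds `g θ'`,
  -- and each pairing integrand is at most `2 ‖φ_m‖ ‖ψ‖`.
  have hu : MemLp (fun y => (L + G * K) * (2 * ‖transverse E m y‖)) 2 volume :=
    ((memLp_transverse E m).norm.const_mul 2).const_mul _
  let A : ℝ × ℝ → ℂ := fun p => transverse E m p.2 0 * ψ p 0 - transverse E m p.2 1 * ψ p 1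
  let B : ℝ × ℝ → ℂ := fun p => transverse E m p.2 1 * ψ p 0 - transverse E m p.2 0 * ψ p 1
  have hT : ∀ i, AEStronglyMeasurable (fun p : ℝ × ℝ => transverse E m p.2 i) volume := fun i =>
    ((contDiff_transverse E m i).continuous.comp continuous_snd).aestronglyMeasurable
  have hψi : ∀ i, AEStronglyMeasurable (fun p => ψ p i) volume := fun i =>
    (continuous_apply i).comp_aestronglyMeasurable hψ.aestronglyMeasurable
  have hA : AEStronglyMeasurable A volume := ((hT 0).mul (hψi 0)).sub ((hT 1).mul (hψi 1))
  have hB : AEStronglyMeasurable B volume := ((hT 1).mul (hψi 0)).sub ((hT 0).mul (hψi 1))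
  have hqA : AEStronglyMeasurable (fun p : ℝ × ℝ => q p.1) volume :=
    (hqm.comp measurable_fst).aestronglyMeasurable
  have hgA : AEStronglyMeasurable (fun p : ℝ × ℝ => (g p.1 : ℂ)) volume :=
    (continuous_ofReal.comp (hg.continuous.comp continuous_fst)).aestronglyMeasurable
  let F : ℕ → ℝ × ℝ → ℂ := fun k p => q p.1 * θ k p.2 * A p +
    g p.1 * ((deriv (θ k) p.2 : ℝ) : ℂ) * B p
  have hF0 : ∀ k, ∫ p, F k p = 0 := fun k => by
    have h := hw _ (contDiff_modeTest E m hg (hθ k)) (hasCompactSupport_modeTest E m hgc (hθc k))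
    simp only [weak_integrand_modeTest E V₁ m hg (hθ k)] at h
    simpa using h
  have hFm : ∀ k, AEStronglyMeasurable (F k) volume := fun k => by
    have h1 : AEStronglyMeasurable (fun p : ℝ × ℝ => (θ k p.2 : ℂ)) volume :=
      (continuous_ofReal.comp ((hθ k).continuous.comp continuous_snd)).aestronglyMeasurable
    have h2 : AEStronglyMeasurable (fun p : ℝ × ℝ => ((deriv (θ k) p.2 : ℝ) : ℂ)) volume :=
      (continuous_ofReal.comp
        (((hθ k).continuous_deriv (by simp)).comp continuous_snd)).aestronglyMeasurable
    exact ((hqA.mul h1).mul hA).add ((hgA.mul h2).mul hB)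
  have hAb := fun p : ℝ × ℝ => (norm_pairing_integrand_le E m p.2 (ψ p)).1
  have hBb := fun p : ℝ × ℝ => (norm_pairing_integrand_le E m p.2 (ψ p)).2
  have hFb : ∀ k p, ‖F k p‖ ≤ ((L + G * K) * (2 * ‖transverse E m p.2‖)) * ‖ψ p‖ := fun k p => by
    have e1 : ‖q p.1 * θ k p.2‖ ≤ L := by
      rw [norm_mul, Complex.norm_real]
      exact (mul_le_of_le_one_right (norm_nonneg _) (hθ1 k _)).trans (hqL _)
    have e2 : ‖(g p.1 : ℂ) * ((deriv (θ k) p.2 : ℝ) : ℂ)‖ ≤ G * K := by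
      rw [norm_mul, Complex.norm_real, Complex.norm_real]
      exact mul_le_mul (hG _) (hθK k _) (norm_nonneg _) hG0
    refine (norm_add_le _ _).trans ?_
    rw [norm_mul, norm_mul (_ * _) (B p)]
    have e3 := mul_le_mul e1 (hAb p) (norm_nonneg _) hL0
    have e4 := mul_le_mul e2 (hBb p) (norm_nonneg _) (mul_nonneg hG0 hK0)
    calc _ ≤ L * (2 * ‖transverse E m p.2‖ * ‖ψ p‖) + G * K * (2 * ‖transverse E m p.2‖ * ‖ψ p‖) :=
          add_le_add e3 e4
      _ = _ := by ring
  have hFs : ∀ k (p : ℝ × ℝ), p.1 ∉ Set.Icc (-R) R → F k p = 0 := fun k p hp => by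
    simp [F, hq0 _ hp, hz _ hp]
  have hlim : ∀ p, Tendsto (fun k => F k p) atTop (𝓝 (q p.1 * A p)) := fun p => by
    have h1 := (continuous_ofReal.tendsto 1).comp (hθlim p.2)
    have h2 := (continuous_ofReal.tendsto 0).comp (hθlim' p.2)
    have := ((h1.const_mul (q p.1)).mul_const (A p)).add ((h2.const_mul (g p.1 : ℂ)).mul_const (B p))
    simpa using this
  have hdom := tendsto_integral_of_dominated_convergence _ hFm
    (hψ.integrable_indicator_strip hu R)
    (fun k => Eventually.of_forall (IsWave.norm_le_indicator_strip
      (u := fun y => (L + G * K) * (2 * ‖transverse E m y‖)) (hFb k) (hFs k)))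
    (Eventually.of_forall hlim)
  simp only [hF0] at hdom
  refine ⟨hψ.integrable_of_bound hu (hqA.mul hA) (R := R) (fun p => ?_) fun p hp => ?_,
    (tendsto_nhds_unique hdom tendsto_const_nhds)⟩
  · exact le_of_tendsto (hlim p).norm (Eventually.of_forall fun k => hFb k p)
  · change q p.1 * A p = 0
    rw [hq0 _ hp, zero_mul]

/-- The decoupled modal equation `q' = i (ξ_m - V₁) q`. Fubini reduces the strip integral to its
weak form on the line. -/
lemma isACPrimitive_modePairing {E : ℝ} {V₁ : ℝ → ℝ} (hV : Measurable V₁) {C : ℝ}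
    (hC : ∀ x, |V₁ x| ≤ C) {ψ : ℝ × ℝ → Fin 2 → ℂ} (hψ : IsWave ψ)
    (hw : IsWeakSolution E (sigma3Potential V₁) ψ 0) (m : Mode) :
    IsACPrimitive (fun x => modePairing E m (fun y => ψ (x, y)))
      (fun x => I * (waveNumber E m - V₁ x) * modePairing E m (fun y => ψ (x, y))) := by
  have hc := hψ.continuous_modePairing E m
  refine isACPrimitive_of_weak hc ?_ fun g hg hgc => ?_
  · rw [locallyIntegrable_iff]
    intro K hK
    refine (IntegrableOn.mul_continuousOn ?_ hc.continuousOn hK)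
    refine Measure.integrableOn_of_bounded (M := ‖waveNumber E m‖ + C) hK.measure_lt_top.ne ?_ ?_
    · exact (measurable_const.mul
        (measurable_const.sub (measurable_ofReal.comp hV))).aestronglyMeasurable
    · refine Eventually.of_forall fun x => ?_
      rw [norm_mul, Complex.norm_I, one_mul]
      refine (norm_sub_le _ _).trans ?_
      rw [Complex.norm_real]
      exact add_le_add le_rfl (hC x)
  · obtain ⟨hi, h0⟩ := integral_strip_pairing_eq_zero hV hC hψ hw m hg hgc
    rw [Measure.volume_eq_prod] at hi h0
    rw [integral_prod _ hi] at h0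
    simp only [integral_const_mul] at h0
    -- The factor `-i` turns `i g' - ξ g + V₁ g` into `g' + i (ξ - V₁) g`, the shape required by
    -- `isACPrimitive_of_weak`.
    have h1 : ∫ x, -I * ((I * ((deriv g x : ℝ) : ℂ) - waveNumber E m * g x + V₁ x * g x) *
        modePairing E m (fun y => ψ (x, y))) = 0 := by
      rw [integral_const_mul]
      simp only [modePairing]
      rw [h0, mul_zero]
    rw [← h1]
    congr 1
    funext x
    linear_combination (((deriv g x : ℝ) : ℂ) * modePairing E m (fun y => ψ (x, y))) * I_mul_I

/-! ### Linearity of the weak form -/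

/-- Compact support of `η` in `y` makes a constant times an indicator an admissible `L²` envelope on
the strip. -/
lemma IsWave.integrable_dotProduct {ψ : ℝ × ℝ → Fin 2 → ℂ} (hψ : IsWave ψ)
    {η : ℝ × ℝ → Fin 2 → ℂ} (hη : Continuous η) (hηc : HasCompactSupport η) :
    Integrable (fun p => η p ⬝ᵥ ψ p) := by
  obtain ⟨R, hR⟩ := hηc.isCompact.isBounded.subset_closedBall 0
  have hz : ∀ p : ℝ × ℝ, (p.1 ∉ Set.Icc (-R) R ∨ p.2 ∉ Set.Icc (-R) R) → η p = 0 := fun p hp => by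
    refine image_eq_zero_of_notMem_tsupport fun h => ?_
    have h1 := hR h
    rw [mem_closedBall_zero_iff, Prod.norm_def, max_le_iff, Real.norm_eq_abs, Real.norm_eq_abs,
      abs_le, abs_le] at h1
    rcases hp with hp | hp
    · exact hp h1.1
    · exact hp h1.2
  obtain ⟨K, hK⟩ := hη.bounded_above_of_compact_support hηc
  have hu : MemLp ((Set.Icc (-R) R).indicator fun _ : ℝ => 2 * K) 2 volume :=
    memLp_indicator_const 2 measurableSet_Icc _ (Or.inr measure_Icc_lt_top.ne)
  refine hψ.integrable_of_bound hu (R := R) ?_ (fun p => ?_) fun p hp => ?_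
  · simp only [dotProduct, Fin.sum_univ_two]
    have h1 : ∀ i, AEStronglyMeasurable (fun p => η p i) volume := fun i =>
      ((continuous_apply i).comp hη).aestronglyMeasurable
    have h2 : ∀ i, AEStronglyMeasurable (fun p => ψ p i) volume := fun i =>
      (continuous_apply i).comp_aestronglyMeasurable hψ.aestronglyMeasurable
    exact ((h1 0).mul (h2 0)).add ((h1 1).mul (h2 1))
  · by_cases hp : p.2 ∈ Set.Icc (-R) R
    · rw [Set.indicator_of_mem hp]
      simp only [dotProduct, Fin.sum_univ_two]
      have h : ∀ i, ‖η p i * ψ p i‖ ≤ K * ‖ψ p‖ := fun i => by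
        rw [norm_mul]
        exact mul_le_mul ((norm_le_pi_norm _ _).trans (hK p)) (norm_le_pi_norm _ _) (norm_nonneg _)
          ((norm_nonneg _).trans (hK p))
      refine (norm_add_le _ _).trans ?_
      linarith [h 0, h 1]
    · rw [hz p (Or.inr hp)]
      simp [Set.indicator_of_notMem hp]
  · rw [hz p (Or.inl hp)]
    simp

lemma continuous_diracFree {χ : ℝ × ℝ → Fin 2 → ℂ} (hχ : ContDiff ℝ ∞ χ) :
    Continuous (diracFree χ) := by
  have h1 : ∀ v, Continuous fun p => fderiv ℝ χ p v := fun v =>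
    (hχ.continuous_fderiv (by simp)).clm_apply continuous_const
  have h0 := hχ.continuous
  have hy : Continuous fun p : ℝ × ℝ => (p.2 : ℂ) := continuous_ofReal.comp continuous_snd
  exact ((continuous_const.matrix_mulVec ((h1 (1, 0)).const_smul (-I))).sub
    (continuous_const.matrix_mulVec ((h1 (0, 1)).const_smul (-I)))).add
    (hy.smul (continuous_const.matrix_mulVec h0))

lemma fderiv_eq_zero_of_notMem_tsupport {χ : ℝ × ℝ → Fin 2 → ℂ} {p : ℝ × ℝ}
    (hp : p ∉ tsupport χ) : fderiv ℝ χ p = 0 := by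
  have h : χ =ᶠ[𝓝 p] fun _ => 0 := notMem_tsupport_iff_eventuallyEq.1 hp
  rw [h.fderiv_eq]
  simp

lemma IsWave.integrable_free {ψ χ : ℝ × ℝ → Fin 2 → ℂ} (hψ : IsWave ψ) (E : ℝ)
    (hχ : ContDiff ℝ ∞ χ) (hχc : HasCompactSupport χ) :
    Integrable (fun p => star (diracFree χ p - (E : ℂ) • χ p) ⬝ᵥ ψ p) := by
  refine hψ.integrable_dotProduct (η := fun p => star (diracFree χ p - (E : ℂ) • χ p)) ?_ ?_
  · exact ((continuous_diracFree hχ).sub (hχ.continuous.const_smul (E : ℂ))).star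
  · refine HasCompactSupport.intro hχc.isCompact fun p hp => ?_
    simp [diracFree, fderiv_eq_zero_of_notMem_tsupport hp, image_eq_zero_of_notMem_tsupport hp]

lemma IsWave.integrable_potential {ψ χ : ℝ × ℝ → Fin 2 → ℂ} (hψ : IsWave ψ)
    (hχ : ContDiff ℝ ∞ χ) (hχc : HasCompactSupport χ) {V₁ : ℝ → ℝ} (hV : Measurable V₁) {C : ℝ}
    (hC : ∀ x, |V₁ x| ≤ C) :
    Integrable (fun p => star (χ p) ⬝ᵥ (sigma3Potential V₁ p *ᵥ ψ p)) := by
  have hη : Continuous fun p => ![star (χ p 0), -star (χ p 1)] := by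
    refine continuous_pi fun i => ?_
    have h : ∀ j, Continuous fun p => star (χ p j) := fun j =>
      ((continuous_apply j).comp hχ.continuous).star
    fin_cases i
    · exact h 0
    · exact (h 1).neg
  have hηc : HasCompactSupport fun p => ![star (χ p 0), -star (χ p 1)] := by
    refine HasCompactSupport.intro hχc.isCompact fun p hp => ?_
    funext i
    fin_cases i <;> simp [image_eq_zero_of_notMem_tsupport hp]
  have h := (hψ.integrable_dotProduct hη hηc).bdd_mul
    (f := fun p : ℝ × ℝ => (V₁ p.1 : ℂ)) (c := C)
    (measurable_ofReal.comp (hV.comp measurable_fst)).aestronglyMeasurable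
    (Eventually.of_forall fun p => by rw [Complex.norm_real]; exact hC _)
  refine h.congr (Eventually.of_forall fun p => ?_)
  beta_reduce
  rw [star_dotProduct_sigma3Potential]
  simp only [dotProduct, Fin.sum_univ_two, Matrix.cons_val_zero, Matrix.cons_val_one]
  ring

section Linearity

variable {E : ℝ} {V₁ : ℝ → ℝ} {C : ℝ} {ψ ψ' : ℝ × ℝ → Fin 2 → ℂ}

lemma IsWeakSolution.add_zero (hV : Measurable V₁) (hC : ∀ x, |V₁ x| ≤ C)
    (hψ : IsWave ψ) (hψ' : IsWave ψ') (h : IsWeakSolution E (sigma3Potential V₁) ψ 0)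
    (h' : IsWeakSolution E (sigma3Potential V₁) ψ' 0) :
    IsWeakSolution E (sigma3Potential V₁) (fun p => ψ p + ψ' p) 0 := fun χ hχ hχc => by
  have e1 := h χ hχ hχc
  have e2 := h' χ hχ hχc
  have i1 := (hψ.integrable_free E hχ hχc).add (hψ.integrable_potential hχ hχc hV hC)
  have i2 := (hψ'.integrable_free E hχ hχc).add (hψ'.integrable_potential hχ hχc hV hC)
  have e3 := integral_add i1 i2
  simp only [Pi.zero_apply, dotProduct_zero, integral_zero] at e1 e2 ⊢
  simp only [Pi.add_apply] at e3
  rw [e1, e2, _root_.add_zero] at e3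
  rw [← e3]
  congr 1
  funext p
  rw [Matrix.mulVec_add, dotProduct_add, dotProduct_add]
  ring

lemma IsWeakSolution.sum_zero (hV : Measurable V₁) (hC : ∀ x, |V₁ x| ≤ C) {ι : Type*}
    (s : Finset ι) {Ψ : ι → ℝ × ℝ → Fin 2 → ℂ} (hw : ∀ i ∈ s, IsWave (Ψ i))
    (h : ∀ i ∈ s, IsWeakSolution E (sigma3Potential V₁) (Ψ i) 0) :
    IsWeakSolution E (sigma3Potential V₁) (fun p => ∑ i ∈ s, Ψ i p) 0 := by
  classical
  induction s using Finset.induction_on with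
  | empty => intro χ _ _; simp
  | insert a s ha ih =>
    simp only [Finset.sum_insert ha]
    have hs : ∀ i ∈ s, i ∈ insert a s := fun i hi => Finset.mem_insert_of_mem hi
    exact IsWeakSolution.add_zero hV hC (hw a (Finset.mem_insert_self a s))
      (IsWave.sum s fun i hi => hw i (hs i hi)) (h a (Finset.mem_insert_self a s))
      (ih (fun i hi => hw i (hs i hi)) fun i hi => h i (hs i hi))

/-- A free solution plus the wave it scatters into is a solution, and conversely. -/
lemma isWeakSolution_scattered_iff (hV : Measurable V₁) (hC : ∀ x, |V₁ x| ≤ C)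
    (hψ : IsWave ψ) (hψ' : IsWave ψ') (h : IsWeakSolution E (sigma3Potential fun _ => 0) ψ 0) :
    IsWeakSolution E (sigma3Potential V₁) ψ' (fun q => -(sigma3Potential V₁ q *ᵥ ψ q)) ↔
      IsWeakSolution E (sigma3Potential V₁) (fun p => ψ p + ψ' p) 0 := by
  refine forall₃_congr fun χ hχ hχc => ?_
  have e1 := h χ hχ hχc
  have f1 := hψ.integrable_free E hχ hχc
  have f2 := hψ'.integrable_free E hχ hχc
  have p1 := hψ.integrable_potential hχ hχc hV hC
  have p2 := hψ'.integrable_potential hχ hχc hV hC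
  have hfree : ∫ p, star (diracFree χ p - (E : ℂ) • χ p) ⬝ᵥ ψ p = 0 := by
    simpa [sigma3Potential] using e1
  have hsum : ∫ p, (star (diracFree χ p - (E : ℂ) • χ p) ⬝ᵥ (ψ p + ψ' p)
      + star (χ p) ⬝ᵥ (sigma3Potential V₁ p *ᵥ (ψ p + ψ' p))) =
      (∫ p, (star (diracFree χ p - (E : ℂ) • χ p) ⬝ᵥ ψ' p
        + star (χ p) ⬝ᵥ (sigma3Potential V₁ p *ᵥ ψ' p))) +
      ∫ p, star (χ p) ⬝ᵥ (sigma3Potential V₁ p *ᵥ ψ p) := by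
    -- Of the four integrals, the free one for `ψ` is split off last, since the free equation makes
    -- it zero.
    have s1 := integral_add (f2.add p2) p1
    have s2 := integral_add ((f2.add p2).add p1) f1
    simp only [Pi.add_apply] at s1 s2
    rw [hfree, _root_.add_zero, s1] at s2
    rw [← s2]
    congr 1
    funext p
    rw [Matrix.mulVec_add, dotProduct_add, dotProduct_add]
    ring
  rw [hsum]
  simp only [Pi.zero_apply, dotProduct_zero, integral_zero, dotProduct_neg, integral_neg]
  exact eq_neg_iff_add_eq_zero

end Linearity

/-! ### Solutions with a single mode -/

/-- The converse of the modal equation for one mode. After testing, the integrand is `P + Q`, where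
`P` is an `x`-derivative almost everywhere along horizontal lines (by the equation for `f`) and `Q`
is a `y`-derivative (by the equation for `φ_m`); both integrate to zero by Fubini. -/
lemma isWeakSolution_mul_transverse {E : ℝ} {V₁ : ℝ → ℝ} (hV : Measurable V₁) {C : ℝ}
    (hC : ∀ x, |V₁ x| ≤ C) (m : Mode) {f : ℝ → ℂ}
    (hf : IsACPrimitive f (fun x => I * (waveNumber E m - V₁ x) * f x)) :
    IsWeakSolution E (sigma3Potential V₁) (fun p => f p.1 • transverse E m p.2) 0 := by
  intro χ hχ hχc
  set A : ℝ → ℂ := fun y => transverse E m y 0 with hA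
  set B : ℝ → ℂ := fun y => transverse E m y 1 with hB
  have hAd : ContDiff ℝ ∞ A := contDiff_transverse E m 0
  have hBd : ContDiff ℝ ∞ B := contDiff_transverse E m 1
  let X : Fin 2 → ℝ × ℝ → ℂ := fun j p => star (fderiv ℝ χ p (1, 0) j)
  let Y : Fin 2 → ℝ × ℝ → ℂ := fun j p => star (fderiv ℝ χ p (0, 1) j)
  let η : Fin 2 → ℝ × ℝ → ℂ := fun j p => star (χ p j)
  have hXc : ∀ j, Continuous (X j) := fun j => ((continuous_apply j).comp
    ((hχ.continuous_fderiv (by simp)).clm_apply continuous_const)).star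
  have hYc : ∀ j, Continuous (Y j) := fun j => ((continuous_apply j).comp
    ((hχ.continuous_fderiv (by simp)).clm_apply continuous_const)).star
  have hηc : ∀ j, Continuous (η j) := fun j => ((continuous_apply j).comp hχ.continuous).star
  have hηd : ∀ j, ContDiff ℝ ∞ (η j) := fun j =>
    conjCLE.contDiff.comp ((contDiff_pi.1 hχ) j)
  have hη0 : ∀ j p, p ∉ tsupport χ → η j p = 0 := fun j p hp => by
    simp [η, image_eq_zero_of_notMem_tsupport hp]
  have hX0 : ∀ j p, p ∉ tsupport χ → X j p = 0 := fun j p hp => by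
    simp [X, fderiv_eq_zero_of_notMem_tsupport hp]
  have hY0 : ∀ j p, p ∉ tsupport χ → Y j p = 0 := fun j p hp => by
    simp [Y, fderiv_eq_zero_of_notMem_tsupport hp]
  have hηx : ∀ j x y, HasDerivAt (fun x => η j (x, y)) (X j (x, y)) x := fun j x y =>
    (hasDerivAt_pi.1 (hasDerivAt_fderiv_fst (hχ.differentiable (by simp) (x, y))) j).star
  have hηy : ∀ j x y, HasDerivAt (fun y => η j (x, y)) (Y j (x, y)) y := fun j x y =>
    (hasDerivAt_pi.1 (hasDerivAt_fderiv_snd (hχ.differentiable (by simp) (x, y))) j).star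
  have hfc := hf.continuous
  have hf1 : Continuous fun p : ℝ × ℝ => f p.1 := hfc.comp continuous_fst
  have hA2 : Continuous fun p : ℝ × ℝ => A p.2 := hAd.continuous.comp continuous_snd
  have hB2 : Continuous fun p : ℝ × ℝ => B p.2 := hBd.continuous.comp continuous_snd
  let r : ℝ → ℂ := fun x => I * (waveNumber E m - V₁ x) * f x
  let A' : ℝ → ℂ := fun y => y * A y - ((E : ℂ) + waveNumber E m) * B y
  let B' : ℝ → ℂ := fun y => ((E : ℂ) - waveNumber E m) * A y - y * B y
  have hA' : ∀ y, HasDerivAt A (A' y) y := hasDerivAt_transverse_zero E m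
  have hB' : ∀ y, HasDerivAt B (B' y) y := hasDerivAt_transverse_one E m
  let P : ℝ × ℝ → ℂ := fun p => I * (X 0 p * A p.2 - X 1 p * B p.2) * f p.1 +
    I * (η 0 p * A p.2 - η 1 p * B p.2) * r p.1
  let Q : ℝ × ℝ → ℂ := fun p =>
    f p.1 * (Y 1 p * A p.2 + η 1 p * A' p.2 - (Y 0 p * B p.2 + η 0 p * B' p.2))
  have hPQ : ∀ p, star (diracFree χ p - (E : ℂ) • χ p) ⬝ᵥ (f p.1 • transverse E m p.2)
      + star (χ p) ⬝ᵥ (sigma3Potential V₁ p *ᵥ (f p.1 • transverse E m p.2)) = P p + Q p :=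
    fun p => by
      rw [star_diracFree_sub_dotProduct, star_dotProduct_sigma3Potential]
      simp only [Pi.smul_apply, smul_eq_mul, P, Q, X, Y, η, r, A', B', hA, hB]
      linear_combination -((star (χ p 0) * transverse E m p.2 0 - star (χ p 1) * transverse E m p.2 1)
        * (waveNumber E m - V₁ p.1) * f p.1) * I_mul_I
  have hQi : Integrable Q := by
    have hy : Continuous fun p : ℝ × ℝ => (p.2 : ℂ) := continuous_ofReal.comp continuous_snd
    have hA'2 : Continuous fun p : ℝ × ℝ => A' p.2 :=
      (hy.mul hA2).sub (continuous_const.mul hB2)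
    have hB'2 : Continuous fun p : ℝ × ℝ => B' p.2 :=
      (continuous_const.mul hA2).sub (hy.mul hB2)
    refine Continuous.integrable_of_hasCompactSupport (hf1.mul
      ((((hYc 1).mul hA2).add ((hηc 1).mul hA'2)).sub
        (((hYc 0).mul hB2).add ((hηc 0).mul hB'2)))) ?_
    exact HasCompactSupport.intro hχc.isCompact fun p hp => by
      simp only [Q]
      rw [hη0 0 p hp, hη0 1 p hp, hY0 0 p hp, hY0 1 p hp]; simp
  have hPi : Integrable P := by
    have i1 : Integrable fun p : ℝ × ℝ => I * (X 0 p * A p.2 - X 1 p * B p.2) * f p.1 := by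
      refine Continuous.integrable_of_hasCompactSupport
        ((continuous_const.mul (((hXc 0).mul hA2).sub ((hXc 1).mul hB2))).mul hf1) ?_
      exact HasCompactSupport.intro hχc.isCompact fun p hp => by
        rw [hX0 0 p hp, hX0 1 p hp]; simp
    have i2 : Integrable fun p : ℝ × ℝ => I * (η 0 p * A p.2 - η 1 p * B p.2) * f p.1 := by
      refine Continuous.integrable_of_hasCompactSupport
        ((continuous_const.mul (((hηc 0).mul hA2).sub ((hηc 1).mul hB2))).mul hf1) ?_
      exact HasCompactSupport.intro hχc.isCompact fun p hp => by simp [hη0 _ p hp]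
    have i3 := i2.bdd_mul (f := fun p : ℝ × ℝ => I * (waveNumber E m - V₁ p.1))
      (c := ‖waveNumber E m‖ + C)
      (measurable_const.mul (measurable_const.sub
        (measurable_ofReal.comp (hV.comp measurable_fst)))).aestronglyMeasurable
      (Eventually.of_forall fun p => by
        rw [norm_mul, Complex.norm_I, one_mul]
        refine (norm_sub_le _ _).trans ?_
        rw [Complex.norm_real]
        exact add_le_add le_rfl (hC _))
    refine (i1.add i3).congr (Eventually.of_forall fun p => ?_)
    simp only [Pi.add_apply, P, r]
    ring
  have hP0 : ∫ p, P p = 0 := by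
    rw [Measure.volume_eq_prod] at hPi ⊢
    rw [integral_prod_symm _ hPi]
    refine integral_eq_zero_of_ae (Eventually.of_forall fun y => ?_)
    have hd : ∀ x, HasDerivAt (fun x => I * (η 0 (x, y) * A y - η 1 (x, y) * B y))
        (I * (X 0 (x, y) * A y - X 1 (x, y) * B y)) x := fun x =>
      (((hηx 0 x y).mul_const (A y)).sub ((hηx 1 x y).mul_const (B y))).const_mul I
    have hs : ∀ j, ContDiff ℝ ∞ fun x => η j (x, y) := fun j =>
      (hηd j).comp (contDiff_id.prodMk contDiff_const)
    have h := hf.integral_test_mul (g := fun x => I * (η 0 (x, y) * A y - η 1 (x, y) * B y))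
      ((contDiff_const.mul (((hs 0).mul contDiff_const).sub
        ((hs 1).mul contDiff_const))).of_le (by exact_mod_cast le_top))
      (HasCompactSupport.intro (hχc.isCompact.image continuous_fst) fun x hx => by
        have : (x, y) ∉ tsupport χ := fun h => hx ⟨_, h, rfl⟩
        simp [hη0 _ _ this])
    have hd' := fun x => (hd x).deriv
    simp only [hd'] at h
    exact h
  have hQ0 : ∫ p, Q p = 0 := by
    rw [Measure.volume_eq_prod] at hQi ⊢
    rw [integral_prod _ hQi]
    refine integral_eq_zero_of_ae (Eventually.of_forall fun x => ?_)
    have hd : ∀ y, HasDerivAt (fun y => f x * (η 1 (x, y) * A y - η 0 (x, y) * B y))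
        (Q (x, y)) y := fun y =>
      (((hηy 1 x y).fun_mul (hA' y)).fun_sub ((hηy 0 x y).fun_mul (hB' y))).const_mul (f x)
    have hs : ∀ j, ContDiff ℝ ∞ fun y => η j (x, y) := fun j =>
      (hηd j).comp (contDiff_const.prodMk contDiff_id)
    -- In the `y` direction everything is smooth, so the absolutely continuous factor is taken to be
    -- `1`.
    have h := (IsACPrimitive.of_contDiff (contDiff_const (c := (1 : ℂ)))).integral_test_mul
      (g := fun y => f x * (η 1 (x, y) * A y - η 0 (x, y) * B y))
      ((contDiff_const.mul (((hs 1).mul hAd).sub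
        ((hs 0).mul hBd))).of_le (by exact_mod_cast le_top))
      (HasCompactSupport.intro (hχc.isCompact.image continuous_snd) fun y hy => by
        have : (x, y) ∉ tsupport χ := fun h => hy ⟨_, h, rfl⟩
        simp [hη0 _ _ this])
    simp only [fun x => (hd x).deriv, deriv_const, mul_one, mul_zero, _root_.add_zero] at h
    exact h
  simp only [hPQ]
  rw [integral_add hPi hQi, hP0, hQ0]
  simp

/-! ### Short-range potentials and their primitives -/

lemma IsShortRange.exists_abs_le {V₁ : ℝ → ℝ} (h : IsShortRange V₁) : ∃ C, ∀ x, |V₁ x| ≤ C := by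
  obtain ⟨s, C, hs, hC⟩ := h
  refine ⟨C, fun x => le_trans ?_ (hC x)⟩
  exact le_mul_of_one_le_left (abs_nonneg _)
    (Real.one_le_rpow (by nlinarith [sq_nonneg x]) (by linarith))

/-- The majorant `C (1 + x²)^(-s/2)` is integrable on the line because `s > 1`. -/
lemma IsShortRange.integrable {V₁ : ℝ → ℝ} (h : IsShortRange V₁) (hV : Measurable V₁) :
    Integrable V₁ := by
  obtain ⟨s, C, hs, hC⟩ := h
  have hi : Integrable (fun x : ℝ => C * ((1 : ℝ) + ‖x‖ ^ 2) ^ (-s / 2)) :=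
    (integrable_rpow_neg_one_add_norm_sq (by simpa using hs)).const_mul C
  refine hi.mono' hV.aestronglyMeasurable (Eventually.of_forall fun x => ?_)
  have hpos : (0 : ℝ) < 1 + x ^ 2 := by positivity
  rw [Real.norm_eq_abs, Real.norm_eq_abs, sq_abs, neg_div, Real.rpow_neg hpos.le,
    ← div_eq_mul_inv, le_div_iff₀ (Real.rpow_pos_of_pos hpos _), mul_comm]
  exact hC x

section Primitive

variable {V₁ : ℝ → ℝ}

lemma tendsto_primitive_atTop (hi : Integrable V₁) :
    Tendsto (primitive V₁) atTop (𝓝 (∫ x, V₁ x)) :=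
  (aecover_Iic tendsto_id).integral_tendsto_of_countably_generated hi

lemma tendsto_primitive_atBot : Tendsto (primitive V₁) atBot (𝓝 0) :=
  tendsto_integral_Iic_zero tendsto_id

lemma primitive_sub (hi : Integrable V₁) (x y : ℝ) :
    primitive V₁ x - primitive V₁ y = ∫ t in y..x, V₁ t :=
  intervalIntegral.integral_Iic_sub_Iic hi.integrableOn hi.integrableOn

lemma primitive_eq_zero {a x : ℝ} (h : ∀ t < a, V₁ t = 0) (hx : x ≤ a) : primitive V₁ x = 0 := by
  -- The hypothesis says nothing about `V₁` at `a` itself, so this null endpoint is dropped.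
  rw [primitive, ← setIntegral_congr_set Iio_ae_eq_Iic]
  exact setIntegral_eq_zero_of_forall_eq_zero fun t ht => h t (lt_of_lt_of_le ht hx)

lemma primitive_eq_integral {b x : ℝ} (h : ∀ t, b < t → V₁ t = 0) (hx : b ≤ x) :
    primitive V₁ x = ∫ t, V₁ t :=
  setIntegral_eq_integral_of_forall_compl_eq_zero fun t ht => h t (hx.trans_lt (not_le.1 ht))

/-- The primitive is Lipschitz because `V₁` is bounded, and so is its phase. Both signs are needed:
`s = 1` for the integrating factor, `s = -1` for the solutions. -/
lemma isACPrimitive_phase (hi : Integrable V₁) {C : ℝ} (hC : ∀ x, |V₁ x| ≤ C) (s : ℝ) :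
    IsACPrimitive (fun x => exp (I * ((s * primitive V₁ x : ℝ) : ℂ)))
      (fun x => I * ((s * V₁ x : ℝ) : ℂ) * exp (I * ((s * primitive V₁ x : ℝ) : ℂ))) := by
  have hC0 : 0 ≤ C := (abs_nonneg _).trans (hC 0)
  have hlip : ∀ x y, ‖exp (I * ((s * primitive V₁ x : ℝ) : ℂ)) -
      exp (I * ((s * primitive V₁ y : ℝ) : ℂ))‖ ≤ |s| * C * |x - y| := fun x y => by
    have e : exp (I * ((s * primitive V₁ x : ℝ) : ℂ)) - exp (I * ((s * primitive V₁ y : ℝ) : ℂ)) =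
        exp (I * ((s * primitive V₁ y : ℝ) : ℂ)) *
          (exp (I * ((s * (primitive V₁ x - primitive V₁ y) : ℝ) : ℂ)) - 1) := by
      rw [mul_sub, ← Complex.exp_add, mul_one]
      congr 2
      push_cast
      ring
    rw [e, norm_mul, mul_comm I, Complex.norm_exp_ofReal_mul_I, one_mul]
    refine Real.norm_exp_I_mul_ofReal_sub_one_le.trans ?_
    rw [norm_mul, Real.norm_eq_abs, mul_assoc, primitive_sub hi]
    exact mul_le_mul_of_nonneg_left
      (intervalIntegral.norm_integral_le_of_norm_le_const fun t _ => hC t) (abs_nonneg s)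
  have hlip' : LipschitzWith (Real.toNNReal (|s| * C))
      (fun x => exp (I * ((s * primitive V₁ x : ℝ) : ℂ))) :=
    LipschitzWith.of_dist_le_mul fun x y => by
      rw [dist_eq_norm, Real.dist_eq, Real.coe_toNNReal _ (by positivity)]
      exact hlip x y
  refine ⟨fun a b => hlip'.lipschitzOnWith.absolutelyContinuousOnInterval, ?_, ?_⟩
  · filter_upwards [_root_.LocallyIntegrable.ae_hasDerivAt_integral hi.locallyIntegrable] with x hx
    have h1 : HasDerivAt (primitive V₁) (V₁ x) x := by
      have : primitive V₁ = fun x => primitive V₁ 0 + ∫ t in (0 : ℝ)..x, V₁ t := by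
        funext x
        rw [← primitive_sub hi]
        ring
      rw [this]
      exact (hx 0).const_add _
    have h2 := ((h1.const_mul s).ofReal_comp.const_mul I).cexp
    convert! h2 using 1
    ring
  · have hloc : LocallyIntegrable (fun x => I * ((s * V₁ x : ℝ) : ℂ)) volume :=
      (((hi.const_mul s).ofReal (𝕜 := ℂ)).const_mul I).locallyIntegrable
    rw [locallyIntegrable_iff]
    intro K hK
    exact (hloc.integrableOn_isCompact hK).mul_continuousOn hlip'.continuous.continuousOn hK

lemma isACPrimitive_amplitude (hi : Integrable V₁) {C : ℝ} (hC : ∀ x, |V₁ x| ≤ C) (s : ℝ)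
    (k ξ : ℂ) :
    IsACPrimitive (fun x => k * exp (I * ξ * x) * exp (I * ((s * primitive V₁ x : ℝ) : ℂ)))
      (fun x => I * (ξ + (s * V₁ x : ℝ)) *
        (k * exp (I * ξ * x) * exp (I * ((s * primitive V₁ x : ℝ) : ℂ)))) := by
  have hd : ∀ x : ℝ, HasDerivAt (fun x : ℝ => k * exp (I * ξ * x))
      (k * (exp (I * ξ * x) * (I * ξ))) x := fun x => by
    have h1 : HasDerivAt (fun x : ℝ => I * ξ * (x : ℂ)) (I * ξ) x := by
      simpa using (hasDerivAt_id x).ofReal_comp.const_mul (I * ξ)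
    exact h1.cexp.const_mul k
  have hc : ContDiff ℝ 1 (fun x : ℝ => k * exp (I * ξ * x)) :=
    contDiff_const.mul ((contDiff_const.mul ofRealCLM.contDiff).cexp)
  convert! (IsACPrimitive.of_contDiff hc).mul (isACPrimitive_phase hi hC s) using 1
  funext x
  rw [(hd x).deriv]
  ring

end Primitive

/-! ### Propagation of the modal coefficients -/

/-- The gauge transformation on coefficients: `exp (-iξ_m x + iW)` is an integrating factor for the
modal equation. It holds for evanescent modes as well. -/
lemma modePairing_propagation {E : ℝ} {V₁ : ℝ → ℝ} (hV : Measurable V₁) (hi : Integrable V₁)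
    {C : ℝ} (hC : ∀ x, |V₁ x| ≤ C) {ψ : ℝ × ℝ → Fin 2 → ℂ}
    (hψ : IsGeneralizedEigenfunction E (sigma3Potential V₁) ψ) (m : Mode) (x y : ℝ) :
    modePairing E m (fun t => ψ (x, t)) * exp (-(I * waveNumber E m * x)) *
        exp (I * (primitive V₁ x : ℂ)) =
      modePairing E m (fun t => ψ (y, t)) * exp (-(I * waveNumber E m * y)) *
        exp (I * (primitive V₁ y : ℂ)) := by
  have h1 := isACPrimitive_modePairing hV hC hψ.1 hψ.2 m
  have h2 := isACPrimitive_amplitude hi hC 1 1 (-waveNumber E m)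
  have h3 := (h1.mul h2).eq_of_ae_zero (Eventually.of_forall fun x => by push_cast; ring) x y
  simpa [mul_assoc] using h3

lemma memLp_normalizedModeWave (E : ℝ) (m : PropMode E) (x : ℝ) :
    MemLp (fun y => normalizedModeWave E m (x, y)) 2 volume :=
  ((memLp_transverse E m.1).const_smul (exp (I * waveNumber E m.1 * (x : ℂ)))).const_smul
    (((E : ℂ) / waveNumber E m.1) ^ (1 / 2 : ℂ))

/-- The factor `√(E/ξ)`. -/
noncomputable def modeScale (E : ℝ) (m : PropMode E) : ℂ :=
  ((E : ℂ) / waveNumber E m.1) ^ (1 / 2 : ℂ)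

lemma modeScale_ne_zero {E : ℝ} (hE : ∀ n : ℕ, E ^ 2 ≠ 2 * (n : ℝ)) (m : PropMode E) :
    modeScale E m ≠ 0 := by
  have hE0 : E ≠ 0 := fun h => hE 0 (by simp [h])
  rw [modeScale, Ne, Complex.cpow_eq_zero_iff, not_and_or]
  left
  exact div_ne_zero (by exact_mod_cast hE0) (waveNumber_ne_zero hE m.1)

lemma modePairing_normalizedModeWave {E : ℝ} (hE : ∀ n : ℕ, E ^ 2 ≠ 2 * (n : ℝ))
    (m p : PropMode E) (x : ℝ) : modePairing E m.1 (fun y => normalizedModeWave E p (x, y)) =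
      if m = p then modeScale E m * exp (I * waveNumber E m.1 * x) * ampSq E m.1 else 0 := by
  simp only [normalizedModeWave, modeWave, modePairing_smul]
  have h := modePairing_transverse hE m.1 p.1
  by_cases hmp : m = p
  · subst hmp
    rw [if_pos rfl] at h ⊢
    rw [show modePairing E m.1 (fun y => transverse E m.1 y) = ampSq E m.1 from h, modeScale]
    ring
  · rw [if_neg fun h => hmp (Subtype.ext h)] at h
    rw [if_neg hmp, show modePairing E m.1 (fun y => transverse E p.1 y) = 0 from h]
    ring

lemma norm_exp_waveNumber {E : ℝ} (m : PropMode E) (x : ℝ) :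
    ‖exp (-(I * waveNumber E m.1 * x))‖ = 1 := by
  obtain ⟨k, hk⟩ := exists_waveNumber_eq_ofReal m
  rw [hk, show -(I * (k : ℂ) * (x : ℂ)) = ((-(k * x) : ℝ) : ℂ) * I by push_cast; ring,
    Complex.norm_exp_ofReal_mul_I]

/-- The pairing is bounded on `L²`, so it passes through the asymptotics and picks out one
amplitude. Multiplying by `exp (-iξ_m x)` does not enlarge the error, because `ξ_m` is real for
propagating modes. -/
lemma HasAsymptotics.tendsto_modePairing {E : ℝ} (hE : ∀ n : ℕ, E ^ 2 ≠ 2 * (n : ℝ))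
    {ψ : ℝ × ℝ → Fin 2 → ℂ} (hψ : IsWave ψ) {l : Filter ℝ} {β : PropMode E → ℂ}
    (h : HasAsymptotics E ψ l β) (m : PropMode E) :
    Tendsto (fun x => modePairing E m.1 (fun y => ψ (x, y)) * exp (-(I * waveNumber E m.1 * x))) l
      (𝓝 (β m * modeScale E m * ampSq E m.1)) := by
  have hsum : ∀ x, MemLp (fun y => ∑ p : PropMode E, β p • normalizedModeWave E p (x, y)) 2 volume :=
    fun x => memLp_finsetSum _ fun p _ => (memLp_normalizedModeWave E p x).const_smul (β p)
  have hpair : ∀ x, modePairing E m.1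
      (fun y => ∑ p : PropMode E, β p • normalizedModeWave E p (x, y)) =
      β m * modeScale E m * ampSq E m.1 * exp (I * waveNumber E m.1 * x) := fun x => by
    rw [modePairing_sum E m.1 _ (fun p y => β p • normalizedModeWave E p (x, y))
      fun p _ => (memLp_normalizedModeWave E p x).const_smul (β p)]
    simp only [modePairing_smul, modePairing_normalizedModeWave hE, mul_ite, mul_zero,
      Finset.sum_ite_eq, Finset.mem_univ, if_true]
    ring
  rw [tendsto_iff_edist_tendsto_0]
  have hlim : Tendsto (fun x => 2 * (eLpNorm (transverse E m.1) 2 volume * eLpNorm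
      (fun y => ψ (x, y) - ∑ p : PropMode E, β p • normalizedModeWave E p (x, y)) 2 volume))
      l (𝓝 0) := by
    have h1 := ENNReal.Tendsto.const_mul (a := eLpNorm (transverse E m.1) 2 volume) h
      (Or.inr (memLp_transverse E m.1).eLpNorm_ne_top)
    have h2 := ENNReal.Tendsto.const_mul (a := 2) h1 (Or.inr (by simp))
    simpa using h2
  refine tendsto_of_tendsto_of_tendsto_of_le_of_le tendsto_const_nhds hlim
    (fun _ => zero_le) fun x => ?_
  have e : modePairing E m.1 (fun y => ψ (x, y)) * exp (-(I * waveNumber E m.1 * x)) -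
      β m * modeScale E m * ampSq E m.1 = modePairing E m.1 (fun y => ψ (x, y) -
        ∑ p : PropMode E, β p • normalizedModeWave E p (x, y)) *
          exp (-(I * waveNumber E m.1 * x)) := by
    rw [modePairing_sub E m.1 (hψ.memLp x) (hsum x), hpair, sub_mul,
      mul_assoc _ (exp (I * _ * _)), ← Complex.exp_add, add_neg_cancel, Complex.exp_zero, mul_one]
  rw [edist_eq_enorm_sub, e, enorm_mul,
    show ‖exp (-(I * waveNumber E m.1 * x))‖ₑ = 1 by
      rw [← ofReal_norm, norm_exp_waveNumber, ENNReal.ofReal_one], mul_one]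
  exact enorm_modePairing_le E m.1 ((hψ.memLp x).sub (hsum x)).1

/-- All propagating amplitudes are multiplied by the same phase. -/
lemma asymptotics_phase {E : ℝ} (hE : ∀ n : ℕ, E ^ 2 ≠ 2 * (n : ℝ)) {V₁ : ℝ → ℝ}
    (hV : Measurable V₁) (hi : Integrable V₁) {C : ℝ} (hC : ∀ x, |V₁ x| ≤ C)
    {ψ : ℝ × ℝ → Fin 2 → ℂ} {βL βR : PropMode E → ℂ}
    (hψ : IsGeneralizedEigenfunction E (sigma3Potential V₁) ψ)
    (hL : HasAsymptotics E ψ atBot βL) (hR : HasAsymptotics E ψ atTop βR) (m : PropMode E) :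
    βR m = exp (-I * ((∫ x : ℝ, V₁ x : ℝ) : ℂ)) * βL m := by
  have hcont : Continuous fun w : ℝ => exp (I * (w : ℂ)) := by fun_prop
  have h1 := (hL.tendsto_modePairing hE hψ.1 m).mul
    ((hcont.tendsto _).comp (tendsto_primitive_atBot (V₁ := V₁)))
  have h2 := (hR.tendsto_modePairing hE hψ.1 m).mul
    ((hcont.tendsto _).comp (tendsto_primitive_atTop hi))
  -- The function whose limits are taken at both ends is constant, so the two limits coincide.
  have hconst : ∀ x, modePairing E m.1 (fun y => ψ (x, y)) * exp (-(I * waveNumber E m.1 * x)) *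
      ((fun w : ℝ => exp (I * (w : ℂ))) ∘ primitive V₁) x =
      modePairing E m.1 (fun t => ψ (0, t)) * exp (-(I * waveNumber E m.1 * (0 : ℝ))) *
        exp (I * (primitive V₁ 0 : ℂ)) := fun x =>
    modePairing_propagation hV hi hC hψ m.1 x 0
  simp only [hconst] at h1 h2
  have h3 := (tendsto_nhds_unique h1 tendsto_const_nhds).trans
    (tendsto_nhds_unique h2 tendsto_const_nhds).symm
  have hκ := mul_ne_zero (modeScale_ne_zero hE m) (ampSq_ne_zero hE m.1)
  simp only [ofReal_zero, mul_zero, Complex.exp_zero, mul_one] at h3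
  have h4 : βL m = βR m * exp (I * ((∫ x : ℝ, V₁ x : ℝ) : ℂ)) := by
    apply mul_right_cancel₀ hκ
    linear_combination h3
  rw [h4, mul_left_comm, ← Complex.exp_add]
  simp

/-! ### The scattering matrix -/

lemma isGeneralizedEigenfunction_mode {E : ℝ} {V₁ : ℝ → ℝ} (hV : Measurable V₁)
    (hi : Integrable V₁) {C : ℝ} (hC : ∀ x, |V₁ x| ≤ C) (m : Mode) (k : ℂ) :
    IsGeneralizedEigenfunction E (sigma3Potential V₁) (fun p =>
      (k * exp (I * waveNumber E m * p.1) * exp (I * ((-1 * primitive V₁ p.1 : ℝ) : ℂ))) •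
        transverse E m p.2) := by
  have h := isACPrimitive_amplitude hi hC (-1) k (waveNumber E m)
  refine ⟨IsWave.mul_transverse h.continuous E m, isWeakSolution_mul_transverse hV hC m
    (f := fun x => k * exp (I * waveNumber E m * x) * exp (I * ((-1 * primitive V₁ x : ℝ) : ℂ))) ?_⟩
  convert! h using 1
  funext x
  push_cast
  ring

/-- The solution is `exp (-iW(x))` times the free superposition with amplitudes `a`. Its distance
from the asymptotic wave is the change of the phase times an `L²` norm bounded uniformly in `x`. -/
lemma exists_eigenfunction {E : ℝ} {V₁ : ℝ → ℝ} (hV : Measurable V₁) (hi : Integrable V₁) {C : ℝ}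
    (hC : ∀ x, |V₁ x| ≤ C) (a : PropMode E → ℂ) :
    ∃ ψ, IsGeneralizedEigenfunction E (sigma3Potential V₁) ψ ∧ HasAsymptotics E ψ atBot a ∧
      HasAsymptotics E ψ atTop (fun m => exp (-I * ((∫ x : ℝ, V₁ x : ℝ) : ℂ)) * a m) := by
  -- This local `W` is the gauge phase itself, not the primitive in its exponent.
  let W : ℝ → ℂ := fun x => exp (I * ((-1 * primitive V₁ x : ℝ) : ℂ))
  let Ψ : PropMode E → ℝ × ℝ → Fin 2 → ℂ := fun m p =>
    ((a m * modeScale E m) * exp (I * waveNumber E m.1 * p.1) *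
      exp (I * ((-1 * primitive V₁ p.1 : ℝ) : ℂ))) • transverse E m.1 p.2
  have hΨ : ∀ m, IsGeneralizedEigenfunction E (sigma3Potential V₁) (Ψ m) := fun m =>
    isGeneralizedEigenfunction_mode hV hi hC m.1 _
  have hΨW : ∀ m p, Ψ m p = W p.1 • a m • normalizedModeWave E m p := fun m p => by
    simp only [Ψ, W, normalizedModeWave, modeWave, modeScale, smul_smul]
    congr 1
    ring
  let B : ℝ≥0∞ := ∑ m : PropMode E, ‖a m * modeScale E m‖ₑ * eLpNorm (transverse E m.1) 2 volume
  have hB : B ≠ ⊤ := (ENNReal.sum_lt_top.2 fun m _ =>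
    ENNReal.mul_lt_top enorm_lt_top (memLp_transverse E m.1).eLpNorm_lt_top).ne
  have hBle : ∀ x, eLpNorm (fun y => ∑ m : PropMode E, a m • normalizedModeWave E m (x, y)) 2 volume
      ≤ B := fun x => by
    have h1 : (fun y => ∑ m : PropMode E, a m • normalizedModeWave E m (x, y)) =
        ∑ m : PropMode E, fun y => a m • normalizedModeWave E m (x, y) := by
      funext y; simp
    rw [h1]
    refine (eLpNorm_sum_le (fun m _ =>
      ((memLp_normalizedModeWave E m x).const_smul (a m)).1) (by norm_num)).trans ?_
    refine Finset.sum_le_sum fun m _ => le_of_eq ?_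
    have h2 : (fun y => a m • normalizedModeWave E m (x, y)) =
        (a m * modeScale E m * exp (I * waveNumber E m.1 * x)) • transverse E m.1 := by
      funext y
      simp only [normalizedModeWave, modeWave, modeScale, smul_smul, Pi.smul_apply]
      congr 1
      ring
    have h3 : ‖exp (I * waveNumber E m.1 * x)‖ₑ = 1 := by
      have := norm_exp_waveNumber m (-x)
      rw [ofReal_neg, mul_neg, neg_neg] at this
      rw [← ofReal_norm, this, ENNReal.ofReal_one]
    refine (congrArg (eLpNorm · 2 volume) h2).trans ?_
    rw [eLpNorm_const_smul, enorm_mul, h3, mul_one]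
  have key : ∀ (l : Filter ℝ) (w : ℝ), Tendsto (primitive V₁) l (𝓝 w) →
      HasAsymptotics E (fun p => ∑ m : PropMode E, Ψ m p) l
        (fun m => exp (-I * (w : ℂ)) * a m) := fun l w hw => by
    have hcont : Continuous fun w : ℝ => exp (I * ((-1 * w : ℝ) : ℂ)) := by fun_prop
    have h1 : Tendsto W l (𝓝 (exp (I * ((-1 * w : ℝ) : ℂ)))) := (hcont.tendsto w).comp hw
    rw [tendsto_iff_edist_tendsto_0] at h1
    have h2 := ENNReal.Tendsto.mul_const (b := B) h1 (Or.inr hB)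
    rw [zero_mul] at h2
    refine tendsto_of_tendsto_of_tendsto_of_le_of_le tendsto_const_nhds h2
      (fun _ => zero_le) fun x => ?_
    have h3 : (fun y => (∑ m : PropMode E, Ψ m (x, y)) -
        ∑ m : PropMode E, (exp (-I * (w : ℂ)) * a m) • normalizedModeWave E m (x, y)) =
        (W x - exp (I * ((-1 * w : ℝ) : ℂ))) •
          fun y => ∑ m : PropMode E, a m • normalizedModeWave E m (x, y) := by
      funext y
      have e : exp (-I * (w : ℂ)) = exp (I * ((-1 * w : ℝ) : ℂ)) := by
        congr 1; push_cast; ring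
      simp only [hΨW, Pi.smul_apply, mul_smul, ← Finset.smul_sum, sub_smul, e]
    beta_reduce
    rw [h3, eLpNorm_const_smul, edist_eq_enorm_sub]
    exact mul_le_mul_right (hBle x) _
  refine ⟨fun p => ∑ m : PropMode E, Ψ m p, ⟨IsWave.sum _ fun m _ => (hΨ m).1,
    IsWeakSolution.sum_zero hV hC _ (fun m _ => (hΨ m).1) fun m _ => (hΨ m).2⟩, ?_,
    key _ _ (tendsto_primitive_atTop hi)⟩
  have := key _ _ (tendsto_primitive_atBot (V₁ := V₁))
  simpa using this

lemma sign_eq_neg_one_of_ne {m : Mode} (h : m.sign ≠ 1) : m.sign = -1 :=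
  (Int.units_eq_one_or m.sign).resolve_left h

lemma isScatteringMatrix_iff {E : ℝ} (hE : ∀ n : ℕ, E ^ 2 ≠ 2 * (n : ℝ)) {V₁ : ℝ → ℝ}
    (hV : Measurable V₁) (hi : Integrable V₁) {C : ℝ} (hC : ∀ x, |V₁ x| ≤ C)
    (S : Matrix (PropMode E) (PropMode E) ℂ) :
    IsScatteringMatrix E (sigma3Potential V₁) S ↔ S = Matrix.diagonal (fun m : PropMode E =>
      exp (-I * ((m.1.sign : ℤ) : ℂ) * ((∫ x : ℝ, V₁ x : ℝ) : ℂ))) := by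
  set w : ℂ := ((∫ x : ℝ, V₁ x : ℝ) : ℂ) with hw
  have hex : ∀ b : PropMode E → ℂ, ∃ (ψ : ℝ × ℝ → Fin 2 → ℂ) (βL βR : PropMode E → ℂ),
      IsGeneralizedEigenfunction E (sigma3Potential V₁) ψ ∧ HasAsymptotics E ψ atBot βL ∧
        HasAsymptotics E ψ atTop βR ∧ incoming βL βR = b := fun b => by
    -- Amplitudes are prescribed at `-∞`. Modes with sign `-1` enter at `+∞`, so theirs are
    -- premultiplied by `exp (iw)` to cancel the phase gained on the way.
    obtain ⟨ψ, h1, h2, h3⟩ := exists_eigenfunction hV hi hC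
      (fun m : PropMode E => if m.1.sign = 1 then b m else exp (I * w) * b m)
    refine ⟨ψ, _, _, h1, h2, h3, ?_⟩
    funext m
    simp only [incoming]
    split_ifs with hs
    · rfl
    · rw [← mul_assoc, ← Complex.exp_add, ← hw]
      simp
  have hout : ∀ (ψ : ℝ × ℝ → Fin 2 → ℂ) (βL βR : PropMode E → ℂ),
      IsGeneralizedEigenfunction E (sigma3Potential V₁) ψ → HasAsymptotics E ψ atBot βL →
      HasAsymptotics E ψ atTop βR → outgoing βL βR = Matrix.diagonal (fun m : PropMode E =>
        exp (-I * ((m.1.sign : ℤ) : ℂ) * w)) *ᵥ incoming βL βR := fun ψ βL βR h1 h2 h3 => by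
    funext m
    have h := asymptotics_phase hE hV hi hC h1 h2 h3 m
    rw [Matrix.mulVec_diagonal]
    simp only [incoming, outgoing]
    split_ifs with hs
    · rw [h, hs]
      simp [hw]
    · rw [h, sign_eq_neg_one_of_ne hs, ← hw, ← mul_assoc, ← Complex.exp_add]
      simp
  constructor
  · rintro ⟨-, hS⟩
    have hmul : ∀ b, S *ᵥ b = Matrix.diagonal (fun m : PropMode E =>
        exp (-I * ((m.1.sign : ℤ) : ℂ) * w)) *ᵥ b := fun b => by
      obtain ⟨ψ, βL, βR, h1, h2, h3, rfl⟩ := hex b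
      rw [← hS ψ βL βR h1 h2 h3, hout ψ βL βR h1 h2 h3]
    exact Matrix.ext_of_mulVec_single fun i => hmul _
  · rintro rfl
    exact ⟨hex, hout⟩

/-! ### The transmission-reflection matrix -/

lemma primitive_zero : primitive (fun _ : ℝ => (0 : ℝ)) = fun _ => 0 := by
  funext x
  simp [primitive]

/-- The side at which the mode `p` enters the slab. -/
noncomputable def entry (xL xR : ℝ) (p : Mode) : ℝ := if p.sign = 1 then xL else xR

lemma incomingWave_eq (E xL xR : ℝ) (p : Mode) : incomingWave E xL xR p = fun q =>
    exp (I * waveNumber E p * ((q.1 - entry xL xR p : ℝ) : ℂ)) • transverse E p q.2 := rfl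

lemma exp_waveNumber_sub (E a x : ℝ) (p : Mode) : exp (I * waveNumber E p * ((x - a : ℝ) : ℂ)) =
    exp (-(I * waveNumber E p * a)) * exp (I * waveNumber E p * x) := by
  rw [← Complex.exp_add]
  congr 1
  push_cast
  ring

lemma isGeneralizedEigenfunction_incomingWave (E xL xR : ℝ) (p : Mode) :
    IsGeneralizedEigenfunction E (sigma3Potential fun _ => 0) (incomingWave E xL xR p) := by
  have h := isGeneralizedEigenfunction_mode (E := E) (V₁ := fun _ => 0) measurable_const
    (integrable_zero _ _ _) (C := 0) (by simp) p (exp (-(I * waveNumber E p * entry xL xR p)))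
  convert! h using 2
  rw [incomingWave_eq]
  beta_reduce
  rw [exp_waveNumber_sub, primitive_zero]
  simp

lemma modeCoeff_mul_transverse {E : ℝ} (hE : ∀ n : ℕ, E ^ 2 ≠ 2 * (n : ℝ)) (m p : Mode)
    (f : ℝ → ℂ) (x : ℝ) :
    modeCoeff E m (fun q => f q.1 • transverse E p q.2) x = if m = p then f x else 0 := by
  rw [modeCoeff_eq hE]
  dsimp only
  rw [modePairing_smul]
  have h := modePairing_transverse hE m p
  rw [show modePairing E m (fun y => transverse E p y) = _ from h]
  have := ampSq_ne_zero hE m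
  split_ifs
  · field_simp
  · simp

lemma modeCoeff_add {E : ℝ} (hE : ∀ n : ℕ, E ^ 2 ≠ 2 * (n : ℝ)) (m : Mode)
    {ψ ψ' : ℝ × ℝ → Fin 2 → ℂ} (h : IsWave ψ) (h' : IsWave ψ') (x : ℝ) :
    modeCoeff E m (fun q => ψ q + ψ' q) x = modeCoeff E m ψ x + modeCoeff E m ψ' x := by
  rw [modeCoeff_eq hE, modeCoeff_eq hE, modeCoeff_eq hE, modePairing_add E m (h.memLp x) (h'.memLp x)]
  ring

section Slab

variable {E : ℝ} {V₁ : ℝ → ℝ} {xL xR : ℝ}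

lemma primitive_left (hsupp : Function.support V₁ ⊆ Set.Icc xL xR) {x : ℝ} (hx : x ≤ xL) :
    primitive V₁ x = 0 :=
  primitive_eq_zero (fun t ht => by
    by_contra h
    exact absurd (hsupp h).1 (not_le.2 ht)) hx

lemma primitive_right (hsupp : Function.support V₁ ⊆ Set.Icc xL xR) {x : ℝ} (hx : xR ≤ x) :
    primitive V₁ x = ∫ t, V₁ t :=
  primitive_eq_integral (fun t ht => by
    by_contra h
    exact absurd (hsupp h).2 (not_le.2 ht)) hx

/-- The total field is `exp (-i (W(x) - W(a)))` times the incoming wave, with `a` the entry side.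
Subtracting the incoming wave leaves the amplitude `D`, which vanishes wherever `W = W(a)`, in
particular on and beyond the entry side: this is the outgoing condition. -/
lemma exists_isOutgoingSolution (hE : ∀ n : ℕ, E ^ 2 ≠ 2 * (n : ℝ)) (hV : Measurable V₁)
    (hi : Integrable V₁) {C : ℝ} (hC : ∀ x, |V₁ x| ≤ C)
    (hsupp : Function.support V₁ ⊆ Set.Icc xL xR) (p : Mode) :
    ∃ ψout, IsOutgoingSolution E (sigma3Potential V₁) xL xR p ψout := by
  set a := entry xL xR p with ha
  let w : ℝ → ℂ := fun x => exp (I * ((-1 * primitive V₁ x : ℝ) : ℂ))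
  let k : ℂ := exp (I * (primitive V₁ a : ℂ))
  let D : ℝ → ℂ := fun x => (k * w x - 1) * exp (I * waveNumber E p * ((x - a : ℝ) : ℂ))
  have hw : Continuous w := (isACPrimitive_phase hi hC (-1)).continuous
  have hD : Continuous D := by
    refine ((continuous_const.mul hw).sub continuous_const).mul ?_
    fun_prop
  have hwave : IsWave (fun q => D q.1 • transverse E p q.2) := IsWave.mul_transverse hD E p
  have hin := isGeneralizedEigenfunction_incomingWave E xL xR p
  have hD0 : ∀ x, primitive V₁ x = primitive V₁ a → D x = 0 := fun x hx => by
    have : k * w x = 1 := by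
      simp only [k, w, hx]
      rw [← Complex.exp_add]
      simp
    simp [D, this]
  refine ⟨fun q => D q.1 • transverse E p q.2, hwave, ?_, fun m hm x hx => ?_, fun m hm x hx => ?_⟩
  · rw [isWeakSolution_scattered_iff hV hC hin.1 hwave hin.2]
    convert! (isGeneralizedEigenfunction_mode (E := E) hV hi hC p
      (k * exp (-(I * waveNumber E p * a)))).2 using 2
    rw [incomingWave_eq, ← add_smul]
    simp only [D, w, ← ha, exp_waveNumber_sub]
    congr 1
    ring
  · rw [modeCoeff_mul_transverse hE]
    split_ifs with h
    · subst h
      refine hD0 x ?_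
      rw [ha, entry, if_pos hm, primitive_left hsupp hx, primitive_left hsupp le_rfl]
    · rfl
  · rw [modeCoeff_mul_transverse hE]
    split_ifs with h
    · subst h
      refine hD0 x ?_
      rw [ha, entry, if_neg (by rw [hm]; decide), primitive_right hsupp hx,
        primitive_right hsupp le_rfl]
    · rfl

/-- On the side where mode `m` would enter, the outgoing field has no `m` component, so the total
coefficient there is `δ_{mp}`. Propagation across the slab gives it on the exit side. This
determines the matrix without any uniqueness of the outgoing solution. -/
lemma modeCoeff_outgoing (hE : ∀ n : ℕ, E ^ 2 ≠ 2 * (n : ℝ)) (hV : Measurable V₁)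
    (hi : Integrable V₁) {C : ℝ} (hC : ∀ x, |V₁ x| ≤ C)
    (hsupp : Function.support V₁ ⊆ Set.Icc xL xR) {p : Mode} {ψout : ℝ × ℝ → Fin 2 → ℂ}
    (h : IsOutgoingSolution E (sigma3Potential V₁) xL xR p ψout) (m : Mode) :
    modeCoeff E m (fun q => incomingWave E xL xR p q + ψout q) (if m.sign = 1 then xR else xL) =
      Matrix.diagonal (fun m : Mode =>
          exp (-I * ((m.sign : ℤ) : ℂ) * ((∫ x : ℝ, V₁ x : ℝ) : ℂ)) *
            exp (I * ((m.sign : ℤ) : ℂ) * waveNumber E m * ((xR - xL : ℝ) : ℂ))) m p := by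
  have hin := isGeneralizedEigenfunction_incomingWave E xL xR p
  have hsol : IsGeneralizedEigenfunction E (sigma3Potential V₁)
      (fun q => incomingWave E xL xR p q + ψout q) :=
    ⟨hin.1.add h.isWave, (isWeakSolution_scattered_iff hV hC hin.1 h.isWave hin.2).1 h.equation⟩
  have hprop := modePairing_propagation hV hi hC hsol m xR xL
  have hκ := ampSq_ne_zero hE m
  have hpair : ∀ x, modePairing E m (fun y => incomingWave E xL xR p (x, y) + ψout (x, y)) =
      ampSq E m * modeCoeff E m (fun q => incomingWave E xL xR p q + ψout q) x := fun x => by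
    rw [modeCoeff_eq hE, mul_inv_cancel_left₀ hκ]
  rw [hpair, hpair, primitive_right hsupp le_rfl, primitive_left hsupp le_rfl] at hprop
  have hprop' : modeCoeff E m (fun q => incomingWave E xL xR p q + ψout q) xR *
      exp (-(I * waveNumber E m * xR)) * exp (I * ((∫ x : ℝ, V₁ x : ℝ) : ℂ)) =
      modeCoeff E m (fun q => incomingWave E xL xR p q + ψout q) xL *
      exp (-(I * waveNumber E m * xL)) := by
    apply mul_left_cancel₀ hκ
    simpa [mul_assoc] using hprop
  have hentry : ∀ x, modeCoeff E m (incomingWave E xL xR p) x =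
      if m = p then exp (I * waveNumber E p * ((x - entry xL xR p : ℝ) : ℂ)) else 0 := fun x =>
    modeCoeff_mul_transverse hE m p
      (fun x => exp (I * waveNumber E p * ((x - entry xL xR p : ℝ) : ℂ))) x
  have hdiag : ∀ d : Mode → ℂ, Matrix.diagonal d m p = d m * if m = p then 1 else 0 := fun d => by
    rw [Matrix.diagonal_apply]; split_ifs <;> simp
  rw [hdiag]
  by_cases hs : m.sign = 1
  · have h1 : modeCoeff E m (fun q => incomingWave E xL xR p q + ψout q) xL =
        if m = p then 1 else 0 := by
      rw [modeCoeff_add hE m hin.1 h.isWave, hentry, h.left m hs xL le_rfl, add_zero]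
      split_ifs with hmp
      · subst hmp; simp [entry, hs]
      · rfl
    rw [h1] at hprop'
    rw [if_pos hs, hs]
    have h2 : exp (-I * (((1 : ℤˣ) : ℤ) : ℂ) * ((∫ x : ℝ, V₁ x : ℝ) : ℂ)) *
        exp (I * ((∫ x : ℝ, V₁ x : ℝ) : ℂ)) = 1 := by
      rw [← Complex.exp_add]; simp
    have h3 : exp (I * (((1 : ℤˣ) : ℤ) : ℂ) * waveNumber E m * ((xR - xL : ℝ) : ℂ)) =
        exp (I * waveNumber E m * xR) * exp (-(I * waveNumber E m * xL)) := by
      rw [← Complex.exp_add]; congr 1; push_cast; ring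
    have h4 : exp (-(I * waveNumber E m * xR)) * exp (I * waveNumber E m * xR) = 1 := by
      rw [← Complex.exp_add]; simp
    have h24 := congrArg₂ (· * ·) h2 h4
    simp only [one_mul] at h24
    have h5 := Complex.exp_ne_zero (-(I * waveNumber E m * xR))
    have h6 := Complex.exp_ne_zero (I * ((∫ x : ℝ, V₁ x : ℝ) : ℂ))
    apply mul_right_cancel₀ h5
    apply mul_right_cancel₀ h6
    rw [hprop', h3]
    generalize (if m = p then (1 : ℂ) else 0) = d
    linear_combination (-d * exp (-(I * waveNumber E m * xL))) * h24
  · have hs' := sign_eq_neg_one_of_ne hs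
    have h1 : modeCoeff E m (fun q => incomingWave E xL xR p q + ψout q) xR =
        if m = p then 1 else 0 := by
      rw [modeCoeff_add hE m hin.1 h.isWave, hentry, h.right m hs' xR le_rfl, add_zero]
      split_ifs with hmp
      · subst hmp; simp [entry, hs]
      · rfl
    rw [h1] at hprop'
    rw [if_neg hs, hs']
    have h2 : exp (-I * (((-1 : ℤˣ) : ℤ) : ℂ) * ((∫ x : ℝ, V₁ x : ℝ) : ℂ)) =
        exp (I * ((∫ x : ℝ, V₁ x : ℝ) : ℂ)) := by
      congr 1; simp
    have h3 : exp (I * (((-1 : ℤˣ) : ℤ) : ℂ) * waveNumber E m * ((xR - xL : ℝ) : ℂ)) =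
        exp (-(I * waveNumber E m * xR)) * exp (I * waveNumber E m * xL) := by
      rw [← Complex.exp_add]; congr 1; push_cast; ring
    have h4 : exp (I * waveNumber E m * xL) * exp (-(I * waveNumber E m * xL)) = 1 := by
      rw [← Complex.exp_add]; simp
    apply mul_right_cancel₀ (Complex.exp_ne_zero (-(I * waveNumber E m * xL)))
    rw [← hprop', h2, h3]
    generalize (if m = p then (1 : ℂ) else 0) = d
    linear_combination (-d * exp (I * ((∫ x : ℝ, V₁ x : ℝ) : ℂ)) *
      exp (-(I * waveNumber E m * xR))) * h4

lemma isTRMatrix_iff (hE : ∀ n : ℕ, E ^ 2 ≠ 2 * (n : ℝ)) (hV : Measurable V₁)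
    (hi : Integrable V₁) {C : ℝ} (hC : ∀ x, |V₁ x| ≤ C)
    (hsupp : Function.support V₁ ⊆ Set.Icc xL xR) (T : Matrix Mode Mode ℂ) :
    IsTRMatrix E (sigma3Potential V₁) xL xR T ↔ T = Matrix.diagonal (fun m : Mode =>
      exp (-I * ((m.sign : ℤ) : ℂ) * ((∫ x : ℝ, V₁ x : ℝ) : ℂ)) *
        exp (I * ((m.sign : ℤ) : ℂ) * waveNumber E m * ((xR - xL : ℝ) : ℂ))) := by
  constructor
  · intro hT
    ext m p
    obtain ⟨⟨ψ, hψ⟩, h⟩ := hT p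
    rw [h ψ hψ m, modeCoeff_outgoing hE hV hi hC hsupp hψ m]
  · rintro rfl p
    exact ⟨exists_isOutgoingSolution hE hV hi hC hsupp p, fun ψ hψ m =>
      (modeCoeff_outgoing hE hV hi hC hsupp hψ m).symm⟩

end Slab

/-! ### The total integral modulo `2π`, and the theorem -/

lemma exp_sign_eq_iff (s : ℤˣ) (a b : ℝ) :
    exp (-I * ((s : ℤ) : ℂ) * (a : ℂ)) = exp (-I * ((s : ℤ) : ℂ) * (b : ℂ)) ↔
      ∃ k : ℤ, a - b = 2 * Real.pi * (k : ℝ) := by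
  rw [Complex.exp_eq_exp_iff_exists_int]
  -- Dividing by `-i s` changes the winding number `n` into `k = -s n`; as `s² = 1`, the
  -- correspondence is invertible.
  have key : ∀ n k : ℤ, n = -(s : ℤ) * k →
      (-I * ((s : ℤ) : ℂ) * (a : ℂ) = -I * ((s : ℤ) : ℂ) * (b : ℂ) + n * (2 * Real.pi * I) ↔
        a - b = 2 * Real.pi * (k : ℝ)) := fun n k hn => by
    have hs : -I * ((s : ℤ) : ℂ) ≠ 0 := by
      rcases Int.units_eq_one_or s with h | h <;> simp [h]
    have h1 : -I * ((s : ℤ) : ℂ) * (a : ℂ) =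
        -I * ((s : ℤ) : ℂ) * (b : ℂ) + n * (2 * Real.pi * I) ↔
        -I * ((s : ℤ) : ℂ) * (a : ℂ) = -I * ((s : ℤ) : ℂ) * ((b + 2 * Real.pi * k : ℝ) : ℂ) := by
      rw [hn]
      push_cast
      constructor <;> intro h <;> linear_combination h
    rw [h1, mul_right_inj' hs, Complex.ofReal_inj]
    constructor <;> intro h <;> linarith
  have hss : (s : ℤ) * (s : ℤ) = 1 := by
    rcases Int.units_eq_one_or s with h | h <;> simp [h]
  constructor
  · rintro ⟨n, hn⟩
    exact ⟨-(s : ℤ) * n, (key n _ (by linear_combination -n * hss)).1 hn⟩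
  · rintro ⟨k, hk⟩
    exact ⟨-(s : ℤ) * k, (key _ k rfl).2 hk⟩

/-- The mode `(0, -1)`. -/
def bottomMode : Mode := ⟨(0, -1), fun _ => rfl⟩

end DiracWaveguide

theorem mainTheorem6 (V₁ : ℝ → ℝ) (hmeas : Measurable V₁) (hV : IsShortRange V₁)
    (E : ℝ) (hE : ∀ n : ℕ, E ^ 2 ≠ 2 * (n : ℝ)) :
    -- the limit `W(+∞)` exists and is the total integral
    (Integrable V₁ volume ∧ Tendsto (primitive V₁) atTop (𝓝 (∫ x : ℝ, V₁ x))) ∧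
    -- from left to right, all propagating amplitudes are multiplied by the same phase
    (∀ (ψ : ℝ × ℝ → Fin 2 → ℂ) (βL βR : PropMode E → ℂ),
      IsGeneralizedEigenfunction E (sigma3Potential V₁) ψ →
      HasAsymptotics E ψ atBot βL → HasAsymptotics E ψ atTop βR →
      ∀ m : PropMode E, βR m = exp (-I * ((∫ x : ℝ, V₁ x : ℝ) : ℂ)) * βL m) ∧
    -- the scattering matrix exists and is this diagonal matrix
    (∀ S : Matrix (PropMode E) (PropMode E) ℂ,
      IsScatteringMatrix E (sigma3Potential V₁) S ↔
        S = Matrix.diagonal (fun m : PropMode E =>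
          exp (-I * ((m.1.sign : ℤ) : ℂ) * ((∫ x : ℝ, V₁ x : ℝ) : ℂ)))) ∧
    -- the transmission-reflection matrix of a slab that contains the support
    (∀ xL xR : ℝ, xL < xR → Function.support V₁ ⊆ Set.Icc xL xR →
      ∀ T : Matrix Mode Mode ℂ, IsTRMatrix E (sigma3Potential V₁) xL xR T ↔
        T = Matrix.diagonal (fun m : Mode =>
          exp (-I * ((m.sign : ℤ) : ℂ) * ((∫ x : ℝ, V₁ x : ℝ) : ℂ)) *
            exp (I * ((m.sign : ℤ) : ℂ) * waveNumber E m * ((xR - xL : ℝ) : ℂ)))) ∧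
    -- the data determine the total integral modulo `2π`, and nothing else
    (∀ V₂ : ℝ → ℝ, Measurable V₂ → IsShortRange V₂ →
      (∀ S₁ S₂ : Matrix (PropMode E) (PropMode E) ℂ,
        IsScatteringMatrix E (sigma3Potential V₁) S₁ →
        IsScatteringMatrix E (sigma3Potential V₂) S₂ →
        (S₁ = S₂ ↔ ∃ k : ℤ, (∫ x : ℝ, V₁ x) - ∫ x : ℝ, V₂ x = 2 * Real.pi * (k : ℝ))) ∧
      (∀ xL xR : ℝ, xL < xR → Function.support V₁ ⊆ Set.Icc xL xR →
        Function.support V₂ ⊆ Set.Icc xL xR →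
        ∀ T₁ T₂ : Matrix Mode Mode ℂ,
        IsTRMatrix E (sigma3Potential V₁) xL xR T₁ →
        IsTRMatrix E (sigma3Potential V₂) xL xR T₂ →
        (T₁ = T₂ ↔ ∃ k : ℤ, (∫ x : ℝ, V₁ x) - ∫ x : ℝ, V₂ x = 2 * Real.pi * (k : ℝ)))) := by
  obtain ⟨C, hC⟩ := hV.exists_abs_le
  have hi := hV.integrable hmeas
  -- Excluding `n = 0` in `E² ≠ 2n` makes `(0, -1)` propagate. The scattering matrix is therefore
  -- never empty and does determine the phase.
  have hbot : 2 * ((bottomMode.level : ℕ) : ℝ) < E ^ 2 := by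
    have h0 : E ^ 2 ≠ 0 := by simpa using hE 0
    have : (0 : ℝ) < E ^ 2 := lt_of_le_of_ne (sq_nonneg E) h0.symm
    simpa [bottomMode, Mode.level] using this
  refine ⟨⟨hi, tendsto_primitive_atTop hi⟩,
    fun ψ βL βR hψ hL hR m => asymptotics_phase hE hmeas hi hC hψ hL hR m,
    isScatteringMatrix_iff hE hmeas hi hC,
    fun xL xR _ hsupp T => isTRMatrix_iff hE hmeas hi hC hsupp T, fun V₂ hmeas₂ hV₂ => ?_⟩
  obtain ⟨C₂, hC₂⟩ := hV₂.exists_abs_le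
  have hi₂ := hV₂.integrable hmeas₂
  refine ⟨fun S₁ S₂ h₁ h₂ => ?_, fun xL xR _ hs₁ hs₂ T₁ T₂ h₁ h₂ => ?_⟩
  · rw [(isScatteringMatrix_iff hE hmeas hi hC S₁).1 h₁,
      (isScatteringMatrix_iff hE hmeas₂ hi₂ hC₂ S₂).1 h₂, Matrix.diagonal_eq_diagonal_iff]
    exact ⟨fun h => (exp_sign_eq_iff bottomMode.sign _ _).1 (h ⟨bottomMode, hbot⟩),
      fun h m => (exp_sign_eq_iff m.1.sign _ _).2 h⟩
  -- The free propagation factor is nonzero and common to both potentials, so it cancels from the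
  -- entry of the mode `(0, -1)`.
  · rw [(isTRMatrix_iff hE hmeas hi hC hs₁ T₁).1 h₁,
      (isTRMatrix_iff hE hmeas₂ hi₂ hC₂ hs₂ T₂).1 h₂, Matrix.diagonal_eq_diagonal_iff]
    exact ⟨fun h => (exp_sign_eq_iff bottomMode.sign _ _).1
        (mul_right_cancel₀ (Complex.exp_ne_zero _) (h bottomMode)),
      fun h m => congrArg (· * _) ((exp_sign_eq_iff m.sign _ _).2 h)⟩
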